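/- **Theorem (Lifting for triangle-DAGs).** Conventions. Clauses are disjunctions of literals over pairwise distinct variables, $\log$ is base $2$, and $\mathrm{IND}_m:[m]\times\{0,1\}^m\to\{0,1\}$ is $\mathrm{IND}_m(x,y)=y_x$. For a CNF formula $F=C_1\wedge\dots\wedge C_\ell$ in $n$ variables, $\mathrm{Search}(F)\circ\mathrm{IND}_m^n$ is the search problem on $X\times Y$, $X=[m]^n$, $Y=(\{0,1\}^m)^n$, in which, given $(x,y)$, one must find an $i\in[\ell]$ such that $C_i(z)=0$, where $z_j=\mathrm{IND}_m(x_j,y_j)$ for $j\in[n]$. A triangle is a set $\{(x,y)\in X\times Y: a(x)<b(y)\}$ with $a:X\to\mathbb R$ and $b:Y\to\mathbb R$. A triangle-DAG solving this search problem is a finite directed acyclic graph with a distinguished root in which every node has at most two children and every node $v$ is labelled by a triangle $T_v$ such that: $T_{\mathrm{root}}=X\times Y$; if $u$ has children, then $T_u$ is contained in the union of the triangles of its children; and if $v$ is a leaf (has no children), then some single $i\in[\ell]$ is a correct answer on every $(x,y)\in T_v$. Its size is its number of nodes, its depth the length of its longest root-to-leaf path. A resolution refutation of $F$ is a sequence of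 clauses ending in the empty clause, each of which is a clause of $F$ or is $C\vee D$ derived from two earlier clauses $C\vee x$, $D\vee\bar x$. Its width is the largest number of literals in one of its clauses, and its depth the number of edges of a longest path in the graph with edges from the premises to the derived clauses. Statement. Let $F$ be an unsatisfiable CNF formula in $n$ variables, and let $m,w\in\mathbb N$ and $\delta>0$ satisfy $w\le n$, $0<\delta<1-\frac1{\log m}$ and $m\ge\left(\frac{50n}{\delta}\right)^{2/\delta}$. If there is a triangle-DAG of size at most $\frac12 m^{(1-\delta)w}$ and depth at most $d$ solving $\mathrm{Search}(F)\circ\mathrm{IND}_m^n$, then $F$ has a resolution refutation of width at most $w$ and depth at most $dw$. -/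

import Mathlib

namespace DagLifting

/-! ### CNF formulas -/

/-- A literal over the variables `z_0, …, z_{n-1}`: the pair `(i, b)` stands for `z_i ^ b`,
that is, for `z_i` if `b = true` and for its negation if `b = false`. -/
abbrev Literal (n : ℕ) := Fin n × Bool

/-- A clause is a disjunction of literals over pairwise distinct variables. -/
@[ext]
structure Clause (n : ℕ) where
  lits : Finset (Literal n)
  distinct : ∀ k ∈ lits, ∀ l ∈ lits, k.1 = l.1 → k = l

/-- The width of a clause is the number of its literals. -/
def Clause.width {n : ℕ} (C : Clause n) : ℕ := C.lits.card

/-- The clause `C` evaluates to `0` on `z`. -/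
def Clause.FalsifiedBy {n : ℕ} (C : Clause n) (z : Fin n → Bool) : Prop :=
  ∀ l ∈ C.lits, z l.1 ≠ l.2

/-- An `n`-variate CNF formula `C_1 ∧ ⋯ ∧ C_ℓ`. -/
abbrev CNF (n : ℕ) := List (Clause n)

/-- No assignment satisfies all clauses of `F`. -/
def Unsatisfiable {n : ℕ} (F : CNF n) : Prop :=
  ∀ z : Fin n → Bool, ∃ C ∈ F, C.FalsifiedBy z

/-! ### Paths in graphs -/

/-- A directed path of the graph with edge relation `E`; its `length` is its number of edges. -/
abbrev Path {V : Type*} (E : V → V → Prop) := RelSeries {p : V × V | E p.1 p.2}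

/-! ### Resolution -/

/-- `E` follows from `A = C ∨ x` and `B = D ∨ ¬x` by the resolution rule: `E = C ∨ D`. -/
def IsResolvent {n : ℕ} (A B E : Clause n) : Prop :=
  ∃ i : Fin n, (i, true) ∈ A.lits ∧ (i, false) ∈ B.lits ∧
    E.lits = A.lits.erase (i, true) ∪ B.lits.erase (i, false)

/-- A resolution refutation of `F`: a sequence of `s + 1` clauses ending in the empty clause, each
of which is a clause of `F` (`premises i = none`) or comes with two specified earlier clauses from
which it follows by the resolution rule (`premises i = some (j, k)`). -/
structure Refutation {n : ℕ} (F : CNF n) where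
  s : ℕ
  clause : Fin (s + 1) → Clause n
  premises : Fin (s + 1) → Option (Fin (s + 1) × Fin (s + 1))
  initial : ∀ i, premises i = none → clause i ∈ F
  derived : ∀ i j k, premises i = some (j, k) →
    j < i ∧ k < i ∧ IsResolvent (clause j) (clause k) (clause i)
  last_empty : (clause (Fin.last s)).lits = ∅

/-- The width of a refutation is the width of its largest clause. -/
def Refutation.width {n : ℕ} {F : CNF n} (P : Refutation F) : ℕ :=
  Finset.univ.sup fun i => (P.clause i).width

/-- There is an edge from each of the two premises of a derived clause to that clause. -/
def Refutation.Edge {n : ℕ} {F : CNF n} (P : Refutation F) (u v : Fin (P.s + 1)) : Prop :=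
  ∃ j k, P.premises v = some (j, k) ∧ (u = j ∨ u = k)

/-- The depth of a refutation is the number of edges of a longest path in its graph. -/
noncomputable def Refutation.depth {n : ℕ} {F : CNF n} (P : Refutation F) : ℕ∞ :=
  ⨆ p : Path P.Edge, (p.length : ℕ∞)

/-! ### Shape-DAGs and triangle-DAGs -/

/-- An `𝓕`-DAG solving the search problem `S ⊆ D × O`, where `𝓕` is a family of subsets of `D`:
a finite acyclic graph with a distinguished root, in which every node has at most two children and
carries a shape from `𝓕`. Nodes without children are leaves. -/
structure ShapeDAG {D O : Type*} (𝓕 : Set (Set D)) (S : D → O → Prop) where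
  V : Type
  [fintypeV : Fintype V]
  root : V
  children : V → Finset V
  shape : V → Set D
  card_children_le : ∀ u, (children u).card ≤ 2
  acyclic : ∀ u, ¬ Relation.TransGen (fun a b => b ∈ children a) u u
  shape_mem : ∀ u, shape u ∈ 𝓕
  shape_root : shape root = Set.univ
  shape_inner : ∀ u, children u ≠ ∅ → shape u ⊆ ⋃ v ∈ children u, shape v
  shape_leaf : ∀ u, children u = ∅ → ∃ o : O, shape u ⊆ {x | S x o}

namespace ShapeDAG

variable {D O : Type*} {𝓕 : Set (Set D)} {S : D → O → Prop}

/-- The size is the number of nodes. -/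
def size (G : ShapeDAG 𝓕 S) : ℕ :=
  letI := G.fintypeV
  Fintype.card G.V

/-- The depth is the length of a longest root-to-leaf path. -/
noncomputable def depth (G : ShapeDAG 𝓕 S) : ℕ∞ :=
  ⨆ p : {p : Path (fun a b => b ∈ G.children a) // p.head = G.root ∧ G.children p.last = ∅},
    (p.1.length : ℕ∞)

end ShapeDAG

/-- The triangles `{(x, y) ∣ a x < b y}` of a bipartite domain `X × Y`. -/
def triangles (X Y : Type*) : Set (Set (X × Y)) :=
  {T | ∃ (a : X → ℝ) (b : Y → ℝ), T = {p | a p.1 < b p.2}}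

/-- A triangle-DAG is a shape-DAG whose shapes are triangles. -/
abbrev TriangleDAG {X Y O : Type*} (S : X × Y → O → Prop) := ShapeDAG (triangles X Y) S

/-! ### Composed search problems -/

/-- The falsified clause search problem: given `z`, find an index `i` with `C_i(z) = 0`. -/
def Search {n : ℕ} (F : CNF n) (z : Fin n → Bool) (i : Fin F.length) : Prop :=
  (F.get i).FalsifiedBy z

/-- The indexing gadget `IND_m(x, y) = y_x`. -/
def IND (m : ℕ) (x : Fin m) (y : Fin m → Bool) : Bool := y x

/-- The composition `S ∘ gⁿ` with a two-party gadget `g : A × B → {0, 1}`, as a search problem on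
the bipartite domain `Aⁿ × Bⁿ`. -/
def compose {n : ℕ} {A B O : Type*} (S : (Fin n → Bool) → O → Prop) (g : A → B → Bool) :
    (Fin n → A) × (Fin n → B) → O → Prop :=
  fun p o => S (fun i => g (p.1 i) (p.2 i)) o

end DagLifting

open DagLifting

/-!
Write `n` for the number of variables, `m` for the gadget size, and let `x` range over the inputs
of the first party, identified with their graphs `{(i, x i)}` as subsets of `Fin n × Fin m`. The
proof walks through the triangle-DAG from the leaves to the root and removes a few `x` and a few `y`
at each node, so that every remaining point of a triangle certifies that a narrow clause is
derivable.

Fix `r = m ^ δ / 3` and let a set of size `t` have cost `r⁻ᵗ`. A family of sets is *small* if it has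
a cover of cost at most `1 / 2`, that is, if there are sets of this total cost such that each member
of the family contains one of them.

*Sunflowers.* If a family of consistent sets of at most `n` literals is not small, then a random
assignment satisfies all literals of some member, up to a failure probability of order `m⁻ⁿ`
(`card_filter_unsatisfied_le`). This is a variant of the Park–Pham theorem: against a random set
`W`, each member of the family can be replaced with a minimal fragment, and the expected cost of the
large fragments is tiny (`sum_cost_fragments_le`), since a fragment `T` is contained in *every*
member of the family inside `W ∪ T`. A first batch of independent rounds shrinks the members to size
`√n`, a second batch hits one of them. That a literal and its negation exclude each other only
helps, as no member contains both (`card_misses_hybrid_le`).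

*Handling sets.* For the triangle `a x < b y` at a node, a set `γ ⊆ x` of positions handles `x` if
the points above `γ` that are no higher than `x` have a link that is not small. A cheapest family of
handling sets for all points costs at most `2 r⁻ᵏ` above any set of size `k`
(`exists_hereditary_handling_family`). Consequently, for two such families, only few `x` are handled
by sets whose union has more than `w` elements (`card_filter_lt_card_union_le`); these `x` are
removed at the parent of the two nodes.

*Clauses.* Suppose that `γ` handles `x`, that `y` lies in the triangle with `x`, and that `ρ` is the
restriction of the gadget values to the variables of `γ`. Barring few `y`, some point `x'` above `γ`
attains every answer pattern extending `ρ` within the triangle, by the sunflower argument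
(`card_bad_le`). Each such answer lies in the triangle of a child, where it is a point certifying a
clause over the variables of the handling set of `x'` at that child. The handling sets of `x'` at
both children have a union of at most `w` variables, so querying these variables derives the clause
`¬ρ` in width `w` and in `w` further steps; variables of `γ` outside the union do not occur in the
derivation (`DerivesWithin.query_all`). At the root the whole space is a triangle, and the argument
for `γ = ∅` derives the empty clause.
-/

namespace DagLifting

open Finset

/-! ### Covers, fragments and a single random round -/

section Small

variable {U : Type*}

/-- The family `𝒰` covers `H`: every member of `H` contains a member of `𝒰`. -/
def Covers (𝒰 H : Finset (Finset U)) : Prop :=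
  ∀ S ∈ H, ∃ T ∈ 𝒰, T ⊆ S

/-- The cost of a family of sets, in which a set of size `t` has cost `r⁻ᵗ`. -/
noncomputable def cost (r : ℝ) (𝒰 : Finset (Finset U)) : ℝ :=
  ∑ T ∈ 𝒰, r⁻¹ ^ T.card

/-- The family `H` has a cover of cost at most `κ`. -/
def IsSmall (r κ : ℝ) (H : Finset (Finset U)) : Prop :=
  ∃ 𝒰, Covers 𝒰 H ∧ cost r 𝒰 ≤ κ

lemma cost_nonneg {r : ℝ} (hr : 0 < r) (𝒰 : Finset (Finset U)) : 0 ≤ cost r 𝒰 :=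
  sum_nonneg fun _ _ => by positivity

lemma cost_mono {r : ℝ} (hr : 0 < r) {𝒰 𝒱 : Finset (Finset U)} (h : 𝒰 ⊆ 𝒱) :
    cost r 𝒰 ≤ cost r 𝒱 :=
  sum_le_sum_of_subset_of_nonneg h fun _ _ _ => by positivity

variable [DecidableEq U]

lemma cost_union_le {r : ℝ} (hr : 0 < r) (𝒰 𝒱 : Finset (Finset U)) :
    cost r (𝒰 ∪ 𝒱) ≤ cost r 𝒰 + cost r 𝒱 := by
  unfold cost
  rw [← sum_union_inter]
  have : 0 ≤ ∑ T ∈ 𝒰 ∩ 𝒱, r⁻¹ ^ T.card := sum_nonneg fun _ _ => by positivity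
  linarith

/-- The fragments of `H` with respect to `W`: the inclusion-minimal sets of the form `S \ W` with
`S ∈ H`. -/
def fragments (H : Finset (Finset U)) (W : Finset U) : Finset (Finset U) :=
  (H.image (· \ W)).filter fun T => ∀ S ∈ H, S \ W ⊆ T → S \ W = T

lemma mem_fragments {H : Finset (Finset U)} {W T : Finset U} :
    T ∈ fragments H W ↔ (∃ S ∈ H, S \ W = T) ∧ ∀ S ∈ H, S \ W ⊆ T → S \ W = T := by
  simp only [fragments, mem_filter, mem_image]

lemma exists_fragment_subset {H : Finset (Finset U)} (W : Finset U) {S : Finset U} (hS : S ∈ H) :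
    ∃ T ∈ fragments H W, T ⊆ S \ W := by
  obtain ⟨T, hT, hmin⟩ := exists_min_image ((H.image (· \ W)).filter (· ⊆ S \ W)) card
    ⟨S \ W, by simp only [mem_filter, mem_image]; exact ⟨⟨S, hS, rfl⟩, Subset.rfl⟩⟩
  rw [mem_filter] at hT
  refine ⟨T, mem_fragments.2 ⟨mem_image.1 hT.1, fun S' hS' hsub => ?_⟩, hT.2⟩
  refine eq_of_subset_of_card_le hsub (hmin _ ?_)
  simp only [mem_filter, mem_image]
  exact ⟨⟨S', hS', rfl⟩, hsub.trans hT.2⟩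

lemma covers_fragments (H : Finset (Finset U)) (W : Finset U) : Covers (fragments H W) H := by
  intro S hS
  obtain ⟨T, hT, h⟩ := exists_fragment_subset W hS
  exact ⟨T, hT, h.trans sdiff_subset⟩

lemma card_le_of_mem_fragments {H : Finset (Finset U)} {W T : Finset U} {s : ℕ}
    (hs : ∀ S ∈ H, S.card ≤ s) (hT : T ∈ fragments H W) : T.card ≤ s := by
  obtain ⟨S, hS, rfl⟩ := (mem_fragments.1 hT).1
  exact (card_le_card sdiff_subset).trans (hs S hS)

end Small

section Rounds

variable {U L : Type*} [Fintype U] [DecidableEq L]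

/-- The set of points that a labelling `f` sends to the distinguished label `o`. -/
def fiberSet (o : L) (f : U → L) : Finset U := univ.filter fun u => f u = o

lemma mem_fiberSet {o : L} {f : U → L} {u : U} : u ∈ fiberSet o f ↔ f u = o := by
  simp [fiberSet]

variable [DecidableEq U] [Fintype L]

/-- Relabelling the points of a set `T` by the distinguished label is at most
`(|L| - 1) ^ |T|`-to-one on the labellings that avoid this label on `T`. -/
lemma card_relabel_le (o : L) (T : Finset U) (P : (U → L) → Prop) [DecidablePred P] :
    (univ.filter fun f : U → L => (∀ u ∈ T, f u ≠ o) ∧ P (T.piecewise (fun _ => o) f)).card ≤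
      (Fintype.card L - 1) ^ T.card * (univ.filter P).card := by
  classical
  have key : (univ.filter fun f : U → L =>
      (∀ u ∈ T, f u ≠ o) ∧ P (T.piecewise (fun _ => o) f)).card ≤
      ((Fintype.piFinset fun _ : T => univ.erase o) ×ˢ univ.filter P).card := by
    refine card_le_card_of_injOn (fun f => (fun u : T => f u, T.piecewise (fun _ => o) f)) ?_ ?_
    · intro f hf
      simp only [coe_filter, mem_univ, true_and, Set.mem_ofPred_eq] at hf
      simp only [coe_product, Set.mem_prod, mem_coe, Fintype.mem_piFinset, mem_erase, mem_univ,
        and_true, mem_filter, true_and]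
      exact ⟨fun u => hf.1 u u.2, hf.2⟩
    · intro f _ g _ hfg
      simp only [Prod.mk.injEq] at hfg
      funext u
      by_cases hu : u ∈ T
      · exact congrFun hfg.1 ⟨u, hu⟩
      · simpa [hu] using congrFun hfg.2 u
  refine key.trans (le_of_eq ?_)
  rw [card_product, Fintype.card_piFinset]
  simp [card_erase_of_mem]

/-- For a random set `W`, adding a fragment `T` to `W` gives a set that contains members of `H`,
and each of them contains `T`. Hence few sets of size `t` occur as a fragment. -/
lemma sum_card_fragments_le (o : L) (H : Finset (Finset U)) {s : ℕ}
    (hs : ∀ S ∈ H, S.card ≤ s) (t : ℕ) :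
    ∑ f : U → L, ((fragments H (fiberSet o f)).filter fun T => T.card = t).card ≤
      Fintype.card (U → L) * ((Fintype.card L - 1) ^ t * s.choose t) := by
  classical
  -- a member of `H` inside `W`, if there is one
  let pick : Finset U → Finset U := fun W => if h : ∃ S ∈ H, S ⊆ W then h.choose else ∅
  have hpick : ∀ W, (pick W).card ≤ s := by
    intro W
    by_cases h : ∃ S ∈ H, S ⊆ W
    · simp only [pick, h, dif_pos]; exact hs _ h.choose_spec.1
    · simp [pick, h]
  have hfrag : ∀ (f : U → L) (T : Finset U), T ∈ fragments H (fiberSet o f) →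
      (∀ u ∈ T, f u ≠ o) ∧ T ⊆ pick (fiberSet o (T.piecewise (fun _ => o) f)) := by
    intro f T hT
    obtain ⟨⟨S, hS, rfl⟩, hmin⟩ := mem_fragments.1 hT
    set W := fiberSet o f
    have hW' : fiberSet o ((S \ W).piecewise (fun _ => o) f) = W ∪ (S \ W) := by
      ext u
      by_cases hu : u ∈ S \ W
      · rw [mem_fiberSet, piecewise_eq_of_mem _ _ _ hu]
        simpa using Or.inr (mem_sdiff.1 hu).1
      · rw [mem_fiberSet, piecewise_eq_of_notMem _ _ _ hu, mem_union, ← mem_fiberSet]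
        simp only [hu, or_false]; rfl
    refine ⟨fun u hu h => (mem_sdiff.1 hu).2 (mem_fiberSet.2 h), ?_⟩
    have hex : ∃ S' ∈ H, S' ⊆ W ∪ (S \ W) :=
      ⟨S, hS, by rw [union_sdiff_self_eq_union]; exact subset_union_right⟩
    rw [hW']
    simp only [pick, hex, dif_pos]
    obtain ⟨h1, h2⟩ := hex.choose_spec
    have h3 : hex.choose \ W ⊆ S \ W := by
      intro u hu
      rw [mem_sdiff] at hu
      exact (mem_union.1 (h2 hu.1)).resolve_left hu.2
    exact (hmin _ h1 h3).symm.subset.trans sdiff_subset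
  calc ∑ f : U → L, ((fragments H (fiberSet o f)).filter fun T => T.card = t).card
      ≤ ∑ f : U → L, ∑ T ∈ powersetCard t univ,
          if (∀ u ∈ T, f u ≠ o) ∧ T ⊆ pick (fiberSet o (T.piecewise (fun _ => o) f))
          then 1 else 0 := by
        refine sum_le_sum fun f _ => ?_
        rw [← card_filter]
        refine card_le_card fun T hT => ?_
        rw [mem_filter] at hT
        simp only [mem_filter, mem_powersetCard, subset_univ, true_and]
        exact ⟨hT.2, hfrag f T hT.1⟩
    _ = ∑ T ∈ powersetCard t (univ : Finset U), (univ.filter fun f : U → L =>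
          (∀ u ∈ T, f u ≠ o) ∧ T ⊆ pick (fiberSet o (T.piecewise (fun _ => o) f))).card := by
        rw [sum_comm]
        exact sum_congr rfl fun T _ => (card_filter _ _).symm
    _ ≤ ∑ T ∈ powersetCard t (univ : Finset U), (Fintype.card L - 1) ^ t *
          (univ.filter fun f : U → L => T ⊆ pick (fiberSet o f)).card := by
        refine sum_le_sum fun T hT => ?_
        have := card_relabel_le o T (fun f => T ⊆ pick (fiberSet o f))
        rwa [(mem_powersetCard.1 hT).2] at this
    _ = (Fintype.card L - 1) ^ t * ∑ f : U → L, ((powersetCard t (univ : Finset U)).filter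
          fun T => T ⊆ pick (fiberSet o f)).card := by
        rw [← mul_sum]
        congr 1
        simp only [card_filter]
        rw [sum_comm]
    _ ≤ (Fintype.card L - 1) ^ t * ∑ f : U → L, s.choose t := by
        refine Nat.mul_le_mul_left _ (sum_le_sum fun f _ => ?_)
        have : ((powersetCard t (univ : Finset U)).filter
          fun T => T ⊆ pick (fiberSet o f)) = powersetCard t (pick (fiberSet o f)) := by
          ext T
          simp only [mem_filter, mem_powersetCard, subset_univ, true_and]
          exact and_comm
        rw [this, card_powersetCard]
        exact Nat.choose_le_choose _ (hpick _)
    _ = _ := by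
        rw [sum_const, smul_eq_mul, card_univ]
        ring

lemma sum_cost_fragments_le (o : L) {r : ℝ} (hr : 0 < r) (H : Finset (Finset U)) {s : ℕ}
    (hs : ∀ S ∈ H, S.card ≤ s) (t₀ : ℕ) :
    ∑ f : U → L, cost r ((fragments H (fiberSet o f)).filter fun T => t₀ ≤ T.card) ≤
      Fintype.card (U → L) *
        ∑ t ∈ Icc t₀ s, s.choose t * (((Fintype.card L - 1 : ℕ) : ℝ) / r) ^ t := by
  have h1 : ∀ f : U → L, cost r ((fragments H (fiberSet o f)).filter fun T => t₀ ≤ T.card) =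
      ∑ t ∈ Icc t₀ s,
        r⁻¹ ^ t * ((fragments H (fiberSet o f)).filter fun T => T.card = t).card := by
    intro f
    unfold cost
    rw [← sum_fiberwise_of_maps_to (g := card) (t := Icc t₀ s)]
    · refine sum_congr rfl fun t ht => ?_
      have : ((fragments H (fiberSet o f)).filter fun T => t₀ ≤ T.card).filter
          (fun T => T.card = t) = (fragments H (fiberSet o f)).filter fun T => T.card = t := by
        ext T
        simp only [mem_filter]
        constructor
        · rintro ⟨⟨h, _⟩, h'⟩; exact ⟨h, h'⟩
        · rintro ⟨h, rfl⟩; exact ⟨⟨h, (mem_Icc.1 ht).1⟩, rfl⟩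
      rw [this, sum_congr rfl (g := fun _ => r⁻¹ ^ t)
        (fun T hT => by rw [(mem_filter.1 hT).2])]
      rw [sum_const, nsmul_eq_mul, mul_comm]
    · intro T hT
      rw [mem_filter] at hT
      exact mem_Icc.2 ⟨hT.2, card_le_of_mem_fragments hs hT.1⟩
  simp only [h1]
  rw [sum_comm, mul_sum]
  refine sum_le_sum fun t _ => ?_
  rw [← mul_sum]
  have := sum_card_fragments_le o H hs t
  have h2 : (∑ f : U → L, (((fragments H (fiberSet o f)).filter fun T => T.card = t).card : ℝ)) ≤
      Fintype.card (U → L) * (((Fintype.card L - 1 : ℕ) : ℝ) ^ t * s.choose t) := by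
    exact_mod_cast this
  calc _ ≤ r⁻¹ ^ t * (Fintype.card (U → L) * (((Fintype.card L - 1 : ℕ) : ℝ) ^ t * s.choose t)) :=
        mul_le_mul_of_nonneg_left h2 (by positivity)
    _ = _ := by rw [div_eq_mul_inv, mul_pow]; ring

lemma card_filter_cost_fragments_le (o : L) {r κ : ℝ} (hr : 0 < r) (hκ : 0 < κ)
    (H : Finset (Finset U)) {s : ℕ} (hs : ∀ S ∈ H, S.card ≤ s) (t₀ : ℕ) :
    ((univ.filter fun f : U → L =>
      κ < cost r ((fragments H (fiberSet o f)).filter fun T => t₀ ≤ T.card)).card : ℝ) ≤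
      κ⁻¹ * (∑ t ∈ Icc t₀ s, s.choose t * (((Fintype.card L - 1 : ℕ) : ℝ) / r) ^ t) *
        Fintype.card (U → L) := by
  have h := sum_cost_fragments_le o hr H hs t₀
  have h2 : κ * ((univ.filter fun f : U → L =>
      κ < cost r ((fragments H (fiberSet o f)).filter fun T => t₀ ≤ T.card)).card : ℝ) ≤
      ∑ f : U → L, cost r ((fragments H (fiberSet o f)).filter fun T => t₀ ≤ T.card) := by
    rw [mul_comm, ← nsmul_eq_mul, ← sum_const]
    refine (sum_le_sum fun f hf => (mem_filter.1 hf).2.le).trans ?_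
    exact sum_le_sum_of_subset_of_nonneg (filter_subset _ _) fun _ _ _ => cost_nonneg hr _
  have h3 := h2.trans h
  rw [inv_mul_eq_div, div_mul_eq_mul_div, le_div_iff₀ hκ]
  linarith

end Rounds

/-! ### Independent rounds -/

section Boost

lemma card_filter_forall_mem_le {ι Ω : Type*} [Fintype ι] [DecidableEq ι] [Fintype Ω]
    [DecidableEq Ω] (B : Finset Ω) {θ : ℝ} (h : (B.card : ℝ) ≤ θ * Fintype.card Ω) :
    ((univ.filter fun f : ι → Ω => ∀ i, f i ∈ B).card : ℝ) ≤
      θ ^ Fintype.card ι * Fintype.card (ι → Ω) := by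
  have h1 : (univ.filter fun f : ι → Ω => ∀ i, f i ∈ B) = Fintype.piFinset fun _ => B := by
    ext f
    simp [Fintype.mem_piFinset]
  rw [h1, Fintype.card_piFinset]
  simp only [prod_const, card_univ, Fintype.card_fun, Nat.cast_pow]
  rw [← mul_pow]
  exact pow_le_pow_left₀ (by positivity) h _

lemma inv_exp_two_ge : (0.135 : ℝ) ≤ Real.exp (-2) := by
  have h1 : Real.exp 1 < 2.7182818286 := Real.exp_one_lt_d9
  have h2 : Real.exp 2 = Real.exp 1 * Real.exp 1 := by rw [← Real.exp_add]; norm_num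
  have h3 : Real.exp 2 ≤ 7.4 := by
    rw [h2]; nlinarith [Real.exp_pos 1]
  rw [Real.exp_neg]
  calc (0.135 : ℝ) ≤ 7.4⁻¹ := by norm_num
    _ ≤ _ := inv_anti₀ (Real.exp_pos _) h3

/-- An upper tail of the binomial expansion of `(1 + q) ^ n`. -/
lemma sum_choose_mul_pow_le {q : ℝ} (hq : 0 ≤ q) (n σ : ℕ) :
    ∑ t ∈ Icc σ n, (n.choose t : ℝ) * q ^ t ≤ (1 + 8 * q) ^ n / 8 ^ σ := by
  rw [le_div_iff₀ (by positivity), sum_mul]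
  calc ∑ t ∈ Icc σ n, (n.choose t : ℝ) * q ^ t * 8 ^ σ
      ≤ ∑ t ∈ Icc σ n, (8 * q) ^ t * 1 ^ (n - t) * (n.choose t : ℝ) := by
        refine sum_le_sum fun t ht => ?_
        have h8 : (8 : ℝ) ^ σ ≤ 8 ^ t := pow_le_pow_right₀ (by norm_num) (mem_Icc.1 ht).1
        rw [one_pow, mul_one, mul_pow]
        have : 0 ≤ (n.choose t : ℝ) * q ^ t := by positivity
        nlinarith
    _ ≤ ∑ t ∈ range (n + 1), (8 * q) ^ t * 1 ^ (n - t) * (n.choose t : ℝ) := by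
        refine sum_le_sum_of_subset_of_nonneg (fun t ht => ?_) fun _ _ _ => by positivity
        rw [mem_range]
        have := (mem_Icc.1 ht).2
        omega
    _ = (1 + 8 * q) ^ n := by rw [← add_pow, add_comm]

lemma tail_sqrt_le {q : ℝ} (hq : 0 ≤ q) {n : ℕ} (hn : 1 ≤ n) (h : q * √n ≤ 0.03) :
    (1 / 4 : ℝ)⁻¹ * ∑ t ∈ Icc (Nat.sqrt n + 1) n, (n.choose t : ℝ) * q ^ t ≤ Real.exp (-2) := by
  set σ := Nat.sqrt n + 1 with hσ
  have hs : √(n : ℝ) ≤ σ := by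
    rw [hσ]; push_cast; exact Real.real_sqrt_le_nat_sqrt_succ
  have hσ2 : 2 ≤ σ := by
    have : 1 ≤ Nat.sqrt n := Nat.le_sqrt.2 (by omega)
    omega
  have hqn : q * n ≤ 0.03 * σ := by
    have h1 : q * n = (q * √n) * √n := by
      rw [mul_assoc, Real.mul_self_sqrt (by positivity)]
    rw [h1]
    exact mul_le_mul h hs (by positivity) (by norm_num)
  have hexp : Real.exp 0.24 ≤ 1.28 := by
    have := Real.exp_bound' (x := 0.24) (by norm_num) (by norm_num) (n := 3) (by norm_num)
    refine this.trans ?_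
    norm_num [Finset.sum_range_succ, Nat.factorial]
  have h1 : (1 + 8 * q) ^ n ≤ 1.28 ^ σ := by
    calc (1 + 8 * q) ^ n ≤ Real.exp (8 * q) ^ n := by
          gcongr
          linarith [Real.add_one_le_exp (8 * q)]
      _ = Real.exp (n * (8 * q)) := (Real.exp_nat_mul _ _).symm
      _ ≤ Real.exp (σ * 0.24) := by
          apply Real.exp_le_exp.2
          nlinarith
      _ = Real.exp 0.24 ^ σ := Real.exp_nat_mul _ _
      _ ≤ _ := by gcongr
  have h2 : (1 + 8 * q) ^ n / 8 ^ σ ≤ 0.0256 := by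
    calc (1 + 8 * q) ^ n / 8 ^ σ ≤ 1.28 ^ σ / 8 ^ σ := by gcongr
      _ = (0.16 : ℝ) ^ σ := by rw [← div_pow]; norm_num
      _ ≤ (0.16 : ℝ) ^ 2 := pow_le_pow_of_le_one (by norm_num) (by norm_num) hσ2
      _ = _ := by norm_num
  have h3 := sum_choose_mul_pow_le hq n σ
  have h4 := inv_exp_two_ge
  norm_num at *
  linarith

lemma head_sqrt_le {q : ℝ} (hq : 0 ≤ q) {n : ℕ} (h : q * √n ≤ 0.03) :
    (1 / 4 : ℝ)⁻¹ * ∑ t ∈ Icc 1 (Nat.sqrt n), ((Nat.sqrt n).choose t : ℝ) * q ^ t ≤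
      Real.exp (-2) := by
  set s := Nat.sqrt n
  have hs : (s : ℝ) ≤ √n := Real.nat_sqrt_le_real_sqrt
  have hqs : s * q ≤ 0.03 := by nlinarith
  have hexp : Real.exp 0.03 ≤ 1.033 := by
    have := Real.exp_bound' (x := 0.03) (by norm_num) (by norm_num) (n := 3) (by norm_num)
    refine this.trans ?_
    norm_num [Finset.sum_range_succ, Nat.factorial]
  have h1 : (1 + q) ^ s ≤ 1.033 := by
    calc (1 + q) ^ s ≤ Real.exp q ^ s := by
          gcongr
          linarith [Real.add_one_le_exp q]
      _ = Real.exp (s * q) := (Real.exp_nat_mul _ _).symm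
      _ ≤ Real.exp 0.03 := Real.exp_le_exp.2 hqs
      _ ≤ _ := hexp
  have h2 : 1 + ∑ t ∈ Icc 1 s, (s.choose t : ℝ) * q ^ t = (1 + q) ^ s := by
    rw [add_comm 1 q, add_pow, range_eq_Ico, sum_eq_sum_Ico_succ_bot (by omega)]
    simp only [pow_zero, one_pow, mul_one, Nat.choose_zero_right, Nat.cast_one]
    congr 1
    refine sum_congr ?_ fun t _ => mul_comm _ _
    ext t
    simp only [mem_Icc, mem_Ico]
    omega
  have h4 := inv_exp_two_ge
  norm_num at *
  linarith

variable {U L : Type*} [Fintype U] [DecidableEq U] [Fintype L] [DecidableEq L]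

lemma card_filter_miss_le (o : L) {r : ℝ} (hr : 0 < r) {n T : ℕ}
    (hq : (((Fintype.card L - 1 : ℕ) : ℝ) / r) * √n ≤ 0.03) (H : Finset (Finset U))
    (hs : ∀ S ∈ H, S.card ≤ Nat.sqrt n) (hH : ¬ IsSmall r (1 / 4) H) :
    ((univ.filter fun f : Fin T → U → L => ∀ S ∈ H, ¬ ∀ u ∈ S, ∃ j, f j u = o).card : ℝ) ≤
      Real.exp (-2) ^ T * Fintype.card (Fin T → U → L) := by
  classical
  set B := univ.filter fun f : U → L =>
      1 / 4 < cost r ((fragments H (fiberSet o f)).filter fun T => 1 ≤ T.card) with hB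
  have h1 : (B.card : ℝ) ≤ Real.exp (-2) * Fintype.card (U → L) :=
    (card_filter_cost_fragments_le o hr (by norm_num) H hs 1).trans
      (mul_le_mul_of_nonneg_right (head_sqrt_le (by positivity) hq) (by positivity))
  have h2 := card_filter_forall_mem_le (ι := Fin T) B h1
  rw [Fintype.card_fin] at h2
  refine le_trans ?_ h2
  refine Nat.cast_le.2 (card_le_card fun f hf => ?_)
  simp only [mem_filter, mem_univ, true_and] at hf ⊢
  intro i
  rw [hB, mem_filter]
  refine ⟨mem_univ _, lt_of_not_ge fun hle => hH ⟨_, ?_, hle⟩⟩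
  intro S hS
  obtain ⟨R, hR, hRS⟩ := covers_fragments H (fiberSet o (f i)) S hS
  refine ⟨R, mem_filter.2 ⟨hR, ?_⟩, hRS⟩
  rw [Nat.one_le_iff_ne_zero, Ne, card_eq_zero]
  rintro rfl
  obtain ⟨⟨S', hS', hsd⟩, -⟩ := mem_fragments.1 hR
  refine hf S' hS' fun u hu => ⟨i, ?_⟩
  rw [sdiff_eq_empty_iff_subset] at hsd
  exact mem_fiberSet.1 (hsd hu)

/-- Two batches of `T` rounds each: some round of the first batch shrinks the sets of `H` to size
at most `√n` at a cost of at most `1 / 4`, and some round of the second batch then contains one of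
the shrunken sets. -/
lemma card_filter_miss_prod_le (o : L) {r : ℝ} (hr : 0 < r) {n T : ℕ} (hn : 1 ≤ n)
    (hq : (((Fintype.card L - 1 : ℕ) : ℝ) / r) * √n ≤ 0.03) (H : Finset (Finset U))
    (hs : ∀ S ∈ H, S.card ≤ n) (hH : ¬ IsSmall r (1 / 2) H) :
    ((univ.filter fun f : (Fin T → U → L) × (Fin T → U → L) =>
      ∀ S ∈ H, ¬ ∀ u ∈ S, (∃ j, f.1 j u = o) ∨ ∃ j, f.2 j u = o).card : ℝ) ≤
      2 * Real.exp (-2) ^ T * (Fintype.card (Fin T → U → L) * Fintype.card (Fin T → U → L)) := by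
  classical
  set σ := Nat.sqrt n + 1 with hσ
  set B := univ.filter fun f : U → L =>
      1 / 4 < cost r ((fragments H (fiberSet o f)).filter fun T => σ ≤ T.card) with hB
  have h1 : (B.card : ℝ) ≤ Real.exp (-2) * Fintype.card (U → L) :=
    (card_filter_cost_fragments_le o hr (by norm_num) H hs σ).trans
      (mul_le_mul_of_nonneg_right (tail_sqrt_le (by positivity) hn hq) (by positivity))
  have h2 := card_filter_forall_mem_le (ι := Fin T) B h1
  rw [Fintype.card_fin] at h2
  set AB := univ.filter fun f : Fin T → U → L => ∀ i, f i ∈ B with hAB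
  have h2' : (AB.card : ℝ) ≤ Real.exp (-2) ^ T * Fintype.card (Fin T → U → L) := by
    convert h2
  set miss : (Fin T → U → L) → (Fin T → U → L) → Prop := fun f g =>
    ∀ S ∈ H, ¬ ∀ u ∈ S, (∃ j, f j u = o) ∨ ∃ j, g j u = o with hmiss
  have h3 : ∀ f : Fin T → U → L, ((univ.filter fun g => miss f g).card : ℝ) ≤
      (if f ∈ AB then (Fintype.card (Fin T → U → L) : ℝ) else 0) +
        Real.exp (-2) ^ T * Fintype.card (Fin T → U → L) := by
    intro f
    by_cases hf : f ∈ AB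
    · rw [if_pos hf]
      have : ((univ.filter fun g => miss f g).card : ℝ) ≤ Fintype.card (Fin T → U → L) :=
        Nat.cast_le.2 (card_le_univ _)
      have h0 : 0 ≤ Real.exp (-2) ^ T * (Fintype.card (Fin T → U → L) : ℝ) := by positivity
      linarith
    · rw [if_neg hf, zero_add]
      rw [hAB, mem_filter, not_and] at hf
      have hf := hf (mem_univ _)
      push Not at hf
      obtain ⟨i, hi⟩ := hf
      have hi' : cost r ((fragments H (fiberSet o (f i))).filter fun T => σ ≤ T.card) ≤ 1 / 4 := by
        by_contra hcon
        exact hi (mem_filter.2 ⟨mem_univ _, not_le.1 hcon⟩)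
      set H' := (fragments H (fiberSet o (f i))).filter fun T => T.card ≤ Nat.sqrt n with hH'
      have hns : ¬ IsSmall r (1 / 4) H' := by
        rintro ⟨𝒰, hcov, hc⟩
        refine hH ⟨𝒰 ∪ (fragments H (fiberSet o (f i))).filter fun T => σ ≤ T.card, ?_, ?_⟩
        · intro S hS
          obtain ⟨R, hR, hRS⟩ := covers_fragments H (fiberSet o (f i)) S hS
          by_cases hc : R.card ≤ Nat.sqrt n
          · obtain ⟨Q, hQ, hQR⟩ := hcov R (mem_filter.2 ⟨hR, hc⟩)
            exact ⟨Q, mem_union_left _ hQ, hQR.trans hRS⟩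
          · exact ⟨R, mem_union_right _ (mem_filter.2 ⟨hR, by omega⟩), hRS⟩
        · refine (cost_union_le hr _ _).trans ?_
          linarith
      refine le_trans ?_ (card_filter_miss_le (T := T) o hr hq H'
        (fun S hS => (mem_filter.1 hS).2) hns)
      refine Nat.cast_le.2 (card_le_card fun g hg => ?_)
      simp only [mem_filter, mem_univ, true_and] at hg ⊢
      intro R hR hcon
      obtain ⟨⟨S, hS, rfl⟩, -⟩ := mem_fragments.1 (mem_filter.1 hR).1
      refine hg S hS fun u hu => ?_
      by_cases hu' : u ∈ fiberSet o (f i)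
      · exact Or.inl ⟨i, mem_fiberSet.1 hu'⟩
      · exact Or.inr (hcon u (mem_sdiff.2 ⟨hu, hu'⟩))
  have h4 : ((univ.filter fun f : (Fin T → U → L) × (Fin T → U → L) => miss f.1 f.2).card : ℝ) =
      ∑ f : Fin T → U → L, ((univ.filter fun g => miss f g).card : ℝ) := by
    simp only [card_filter, Nat.cast_sum]
    rw [← univ_product_univ, sum_product]
  refine h4.le.trans ((sum_le_sum fun f _ => h3 f).trans ?_)
  rw [sum_add_distrib, sum_const, nsmul_eq_mul, card_univ, sum_ite_mem, univ_inter, sum_const,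
    nsmul_eq_mul]
  have := mul_le_mul_of_nonneg_right h2'
    (show 0 ≤ (Fintype.card (Fin T → U → L) : ℝ) by positivity)
  linarith

end Boost

/-! ### Uniformly random assignments -/

section Coupling

variable {U L : Type*} [Fintype U] [DecidableEq U] [Fintype L] [DecidableEq L]

/-- The number of labellings which put exactly the points of a given set into labels from `A`. -/
lemma card_filter_decide_mem_eq (A : Finset L) (hA : 2 * A.card = Fintype.card L)
    (b : U → Bool) :
    (univ.filter fun g : U → L => (fun u => decide (g u ∈ A)) = b).card =
      A.card ^ Fintype.card U := by
  have h1 : (univ.filter fun g : U → L => (fun u => decide (g u ∈ A)) = b) =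
      Fintype.piFinset fun u => if b u then A else Aᶜ := by
    ext g
    simp only [mem_filter, mem_univ, true_and, Fintype.mem_piFinset, funext_iff]
    refine forall_congr' fun u => ?_
    cases b u <;> simp
  rw [h1, Fintype.card_piFinset, ← card_univ, ← prod_const]
  refine prod_congr rfl fun u _ => ?_
  cases b u
  · simp only [Bool.false_eq_true, if_false, card_compl]; omega
  · simp

lemma card_filter_apply_eq_mul {J : Type*} [Fintype J] [DecidableEq J] (j : J) (o : L) :
    (univ.filter fun ℓ : J → L => ℓ j = o).card * Fintype.card L = Fintype.card (J → L) := by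
  have h3 : (univ.filter fun ℓ : J → L => ℓ j = o) =
      Fintype.piFinset fun i => if i = j then {o} else univ := by
    ext ℓ
    simp only [mem_filter, mem_univ, true_and, Fintype.mem_piFinset]
    constructor
    · intro h i
      by_cases hi : i = j
      · subst hi; simp [h]
      · simp [hi]
    · intro h
      simpa using h j
  have h4 : ∀ i, (if i = j then ({o} : Finset L) else univ).card =
      if i = j then 1 else Fintype.card L := by
    intro i
    split_ifs <;> simp
  rw [h3, Fintype.card_piFinset, prod_congr rfl fun i _ => h4 i, Fintype.card_fun]
  rw [prod_ite, prod_const_one, one_mul, prod_const, ← pow_succ]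
  congr 1
  have : (univ.filter fun i : J => ¬ i = j) = univ.erase j := by ext; simp
  have hpos : 0 < Fintype.card J := Fintype.card_pos_iff.2 ⟨j⟩
  rw [this, card_erase_of_mem (mem_univ _), card_univ]
  omega

/-- A family that is not small is hit by a uniformly random set except with probability
`2 * exp (-2 * T)`. The random set is coupled to contain the union of `2 * T` independent sets of
density `1 / (4 * T)`, which serve as the rounds of `card_filter_miss_prod_le`. -/
theorem card_filter_miss_bool_le {r : ℝ} (hr : 0 < r) {n T : ℕ} (hn : 1 ≤ n) (hT : 1 ≤ T)
    (hq : 4 * T * √n ≤ 0.03 * r) (H : Finset (Finset U))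
    (hs : ∀ S ∈ H, S.card ≤ n) (hH : ¬ IsSmall r (1 / 2) H) :
    ((univ.filter fun b : U → Bool => ∀ S ∈ H, ¬ ∀ u ∈ S, b u = true).card : ℝ) ≤
      2 * Real.exp (-2) ^ T * 2 ^ Fintype.card U := by
  classical
  obtain ⟨N, hN⟩ : ∃ N, 4 * T = N + 1 := ⟨4 * T - 1, by omega⟩
  set J := Fin T ⊕ Fin T
  set K := J → Fin (N + 1)
  have hq' : (((Fintype.card (Fin (N + 1)) - 1 : ℕ) : ℝ) / r) * √n ≤ 0.03 := by
    rw [Fintype.card_fin, Nat.add_sub_cancel, div_mul_eq_mul_div, div_le_iff₀ hr]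
    refine le_trans ?_ hq
    gcongr
    have : ((4 * T : ℕ) : ℝ) = N + 1 := by rw [hN]; push_cast; ring
    push_cast at this
    linarith
  have hmain := card_filter_miss_prod_le (L := Fin (N + 1)) (T := T) 0 hr hn hq' H hs hH
  -- the labels under which a point belongs to some round
  set E : Finset K := univ.filter fun ℓ => ∃ j, ℓ j = 0 with hE
  have hK : Fintype.card K = (4 * T) ^ (2 * T) := by
    simp only [K, J, Fintype.card_fun, Fintype.card_sum, Fintype.card_fin, ← hN, two_mul]
  have hEcard : E.card * (4 * T) ≤ 2 * T * Fintype.card K := by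
    have h1 : E ⊆ univ.biUnion fun j : J => univ.filter fun ℓ : K => ℓ j = 0 := by
      intro ℓ hℓ
      obtain ⟨j, hj⟩ := (mem_filter.1 hℓ).2
      exact mem_biUnion.2 ⟨j, mem_univ _, mem_filter.2 ⟨mem_univ _, hj⟩⟩
    have h2 : ∀ j : J, (univ.filter fun ℓ : K => ℓ j = 0).card * (4 * T) = Fintype.card K := by
      intro j
      rw [← card_filter_apply_eq_mul j (0 : Fin (N + 1)), Fintype.card_fin, hN]
    calc E.card * (4 * T) ≤ (∑ j : J, (univ.filter fun ℓ : K => ℓ j = 0).card) * (4 * T) :=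
          Nat.mul_le_mul_right _ ((card_le_card h1).trans card_biUnion_le)
      _ = 2 * T * Fintype.card K := by
          rw [sum_mul, sum_congr rfl fun j _ => h2 j, sum_const, card_univ, smul_eq_mul]
          simp only [J, Fintype.card_sum, Fintype.card_fin, two_mul]
  have hEcard' : 2 * E.card ≤ Fintype.card K := by
    have : T * (2 * (2 * E.card)) ≤ T * (2 * Fintype.card K) := by
      calc _ = E.card * (4 * T) := by ring
        _ ≤ _ := hEcard
        _ = _ := by ring
    have := Nat.le_of_mul_le_mul_left this (by omega)
    omega
  obtain ⟨M, hM⟩ : ∃ M, Fintype.card K = 2 * M := by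
    have : 2 ∣ Fintype.card K := by
      rw [hK]; exact dvd_pow (Dvd.intro_left (2 * T) (by ring)) (by omega)
    exact this
  obtain ⟨A, hEA, -, hAM⟩ := exists_subsuperset_card_eq (subset_univ E) (n := M) (by omega)
    (by rw [card_univ]; omega)
  have hMpos : 0 < M := by
    have : 0 < Fintype.card K := Fintype.card_pos
    omega
  -- each set of points comes from the same number of labellings
  have hfib : (univ.filter fun b : U → Bool => ∀ S ∈ H, ¬ ∀ u ∈ S, b u = true).card *
      M ^ Fintype.card U =
      (univ.filter fun g : U → K => ∀ S ∈ H, ¬ ∀ u ∈ S, g u ∈ A).card := by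
    rw [card_eq_sum_card_fiberwise (f := fun g : U → K => fun u => decide (g u ∈ A))
      (t := univ.filter fun b : U → Bool => ∀ S ∈ H, ¬ ∀ u ∈ S, b u = true)]
    · rw [← smul_eq_mul, ← sum_const]
      refine sum_congr rfl fun b hb => ?_
      rw [← hAM, ← card_filter_decide_mem_eq A (by omega) b]
      congr 1
      ext g
      simp only [mem_filter, mem_univ, true_and] at hb ⊢
      constructor
      · rintro rfl
        exact ⟨by simpa using hb, rfl⟩
      · exact fun h => h.2
    · intro g hg
      simp only [coe_filter, mem_univ, true_and, Set.mem_ofPred_eq] at hg ⊢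
      simpa using hg
  have hinj : (univ.filter fun g : U → K => ∀ S ∈ H, ¬ ∀ u ∈ S, g u ∈ A).card ≤
      (univ.filter fun f : (Fin T → U → Fin (N + 1)) × (Fin T → U → Fin (N + 1)) =>
        ∀ S ∈ H, ¬ ∀ u ∈ S, (∃ j, f.1 j u = 0) ∨ ∃ j, f.2 j u = 0).card := by
    refine card_le_card_of_injOn
      (fun g => (fun j u => g u (Sum.inl j), fun j u => g u (Sum.inr j))) ?_ ?_
    · intro g hg
      simp only [coe_filter, mem_univ, true_and, Set.mem_ofPred_eq] at hg ⊢
      intro S hS h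
      refine hg S hS fun u hu => hEA (mem_filter.2 ⟨mem_univ _, ?_⟩)
      rcases h u hu with ⟨j, hj⟩ | ⟨j, hj⟩
      exacts [⟨_, hj⟩, ⟨_, hj⟩]
    · intro g _ g' _ h
      simp only [Prod.mk.injEq] at h
      funext u j
      rcases j with j | j
      · exact congrFun (congrFun h.1 j) u
      · exact congrFun (congrFun h.2 j) u
  have hcardeq : Fintype.card (Fin T → U → Fin (N + 1)) * Fintype.card (Fin T → U → Fin (N + 1)) =
      2 ^ Fintype.card U * M ^ Fintype.card U := by
    rw [← mul_pow, ← hM, hK]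
    simp only [Fintype.card_fun, Fintype.card_fin, ← hN]
    rw [← pow_mul, ← pow_mul, ← pow_add]
    congr 1
    ring
  have hfin : ((univ.filter fun b : U → Bool => ∀ S ∈ H, ¬ ∀ u ∈ S, b u = true).card : ℝ) *
      (M : ℝ) ^ Fintype.card U ≤
      2 * Real.exp (-2) ^ T * 2 ^ Fintype.card U * (M : ℝ) ^ Fintype.card U := by
    calc _ = (((univ.filter fun g : U → K => ∀ S ∈ H, ¬ ∀ u ∈ S, g u ∈ A).card : ℕ) : ℝ) := by
          rw [← hfib]; push_cast; rfl
      _ ≤ _ := Nat.cast_le.2 hinj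
      _ ≤ _ := hmain
      _ = 2 * Real.exp (-2) ^ T * ((2 ^ Fintype.card U * M ^ Fintype.card U : ℕ) : ℝ) := by
          rw [← hcardeq]; push_cast; rfl
      _ = _ := by push_cast; ring
  exact le_of_mul_le_mul_right hfin (by positivity)

end Coupling

section Exclusive

variable {Q : Type*}

/-- No set of literals from `H` is contained in the set of literals `{(u, t) | d u t}`. -/
def Misses (H : Finset (Finset (Q × Bool))) (d : Q → Bool → Bool) : Prop :=
  ∀ S ∈ H, ¬ ∀ l ∈ S, d l.1 l.2 = true

lemma Misses.anti {H : Finset (Finset (Q × Bool))} {d d' : Q → Bool → Bool} (h : Misses H d)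
    (hd : ∀ u t, d' u t = true → d u t = true) : Misses H d' :=
  fun S hS hcon => h S hS fun l hl => hd _ _ (hcon l hl)

/-- The literals at a position that are present when the position holds the bit `v.1`. -/
def exclusiveBits (v : Bool × Bool) : Bool → Bool := fun t => v.1 == t

/-- The literals at a position that are present when `v` decides on the two literals separately. -/
def separateBits (v : Bool × Bool) : Bool → Bool := fun t => if t then v.1 else v.2

variable [DecidableEq Q]

open Classical in
/-- Replacing separate choices by an exclusive choice at one position can only help to contain a
member of `H`, since no member uses both literals at that position. -/
lemma sum_misses_exclusive_le (H : Finset (Finset (Q × Bool)))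
    (hH : ∀ S ∈ H, ∀ u, ¬ ((u, true) ∈ S ∧ (u, false) ∈ S)) (d : Q → Bool → Bool) (u : Q) :
    ∑ v : Bool × Bool, (if Misses H (Function.update d u (exclusiveBits v)) then 1 else 0) ≤
      ∑ v : Bool × Bool, (if Misses H (Function.update d u (separateBits v)) then 1 else 0) := by
  have hmono : ∀ e e' : Bool → Bool, (∀ t, e' t = true → e t = true) →
      Misses H (Function.update d u e) → Misses H (Function.update d u e') := by
    intro e e' he h
    refine h.anti fun u' t => ?_
    by_cases hu : u' = u
    · subst hu; simpa using he t
    · simp [hu]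
  have hboth : Misses H (Function.update d u (exclusiveBits (true, true))) →
      Misses H (Function.update d u (exclusiveBits (false, true))) →
      Misses H (Function.update d u (separateBits (true, true))) := by
    intro h1 h0 S hS hcon
    by_cases ht : (u, true) ∈ S
    · refine h1 S hS fun l hl => ?_
      have := hcon l hl
      by_cases hu : l.1 = u
      · have hl2 : l.2 = true := by
          by_contra hf
          refine hH S hS u ⟨ht, ?_⟩
          have : l = (u, false) := Prod.ext hu (by simpa using hf)
          exact this ▸ hl
        rw [hu, hl2]; simp [exclusiveBits]
      · simpa [hu] using this
    · refine h0 S hS fun l hl => ?_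
      have := hcon l hl
      by_cases hu : l.1 = u
      · have hl2 : l.2 = false := by
          by_contra hf
          refine ht ?_
          have : l = (u, true) := Prod.ext hu (by simpa using hf)
          exact this ▸ hl
        rw [hu, hl2]; simp [exclusiveBits]
      · simpa [hu] using this
  have e1 : exclusiveBits (true, false) = exclusiveBits (true, true) := rfl
  have e2 : exclusiveBits (false, false) = exclusiveBits (false, true) := rfl
  have s1 : separateBits (true, false) = exclusiveBits (true, true) := by
    funext t; cases t <;> rfl
  have s2 : separateBits (false, true) = exclusiveBits (false, true) := by
    funext t; cases t <;> rfl
  have m1 := hmono (exclusiveBits (true, true)) (separateBits (false, false))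
    (fun t => by cases t <;> simp [separateBits])
  have m2 := hmono (exclusiveBits (false, true)) (separateBits (false, false))
    (fun t => by cases t <;> simp [separateBits])
  simp only [Fintype.sum_prod_type, Fintype.sum_bool, e1, e2, s1, s2]
  split_ifs <;> first | omega | (exfalso; tauto)

variable [Fintype Q]

open Classical in
lemma card_misses_hybrid_le (H : Finset (Finset (Q × Bool)))
    (hH : ∀ S ∈ H, ∀ u, ¬ ((u, true) ∈ S ∧ (u, false) ∈ S)) (R : Finset Q) :
    (univ.filter fun c : Q → Bool × Bool => Misses H fun u =>
      if u ∈ R then exclusiveBits (c u) else separateBits (c u)).card ≤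
    (univ.filter fun c : Q → Bool × Bool => Misses H fun u => separateBits (c u)).card := by
  induction R using Finset.induction_on with
  | empty => simp
  | insert u R hu ih =>
    refine le_trans ?_ ih
    simp only [card_filter]
    have hsplit : ∀ f : (Q → Bool × Bool) → ℕ, ∑ c, f c =
        ∑ rest : {j // j ≠ u} → Bool × Bool, ∑ v,
          f ((Equiv.funSplitAt u (Bool × Bool)).symm (v, rest)) := by
      intro f
      rw [← (Equiv.funSplitAt u (Bool × Bool)).symm.sum_comp, Fintype.sum_prod_type_right]
    rw [hsplit, hsplit]
    refine sum_le_sum fun rest _ => ?_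
    -- the literals present at the positions other than `u`
    let d : Q → Bool → Bool := fun j =>
      if h : j = u then fun _ => false else
        if j ∈ R then exclusiveBits (rest ⟨j, h⟩) else separateBits (rest ⟨j, h⟩)
    have hd1 : ∀ v, (fun j => if j ∈ insert u R then
        exclusiveBits ((Equiv.funSplitAt u (Bool × Bool)).symm (v, rest) j) else
        separateBits ((Equiv.funSplitAt u (Bool × Bool)).symm (v, rest) j)) =
        Function.update d u (exclusiveBits v) := by
      intro v
      funext j
      by_cases hj : j = u
      · subst hj; simp [Equiv.funSplitAt]
      · simp [Equiv.funSplitAt, hj, d]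
    have hd2 : ∀ v, (fun j => if j ∈ R then
        exclusiveBits ((Equiv.funSplitAt u (Bool × Bool)).symm (v, rest) j) else
        separateBits ((Equiv.funSplitAt u (Bool × Bool)).symm (v, rest) j)) =
        Function.update d u (separateBits v) := by
      intro v
      funext j
      by_cases hj : j = u
      · subst hj; simp [Equiv.funSplitAt, hu]
      · simp [Equiv.funSplitAt, hj, d]
    simp only [hd1, hd2]
    exact sum_misses_exclusive_le H hH d u

/-- A family of consistent sets of literals which is not small contains, except with probability
`2 * exp (-2 * T)`, a set of literals satisfied by a uniformly random assignment. -/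
theorem card_filter_unsatisfied_le {r : ℝ} (hr : 0 < r) {n T : ℕ} (hn : 1 ≤ n) (hT : 1 ≤ T)
    (hq : 4 * T * √n ≤ 0.03 * r) (H : Finset (Finset (Q × Bool)))
    (hc : ∀ S ∈ H, ∀ u, ¬ ((u, true) ∈ S ∧ (u, false) ∈ S))
    (hs : ∀ S ∈ H, S.card ≤ n) (hH : ¬ IsSmall r (1 / 2) H) :
    ((univ.filter fun y : Q → Bool => ∀ S ∈ H, ¬ ∀ l ∈ S, y l.1 = l.2).card : ℝ) ≤
      2 * Real.exp (-2) ^ T * 2 ^ Fintype.card Q := by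
  classical
  have h1 := card_filter_miss_bool_le hr hn hT hq H hs hH
  have h2 := card_misses_hybrid_le H hc univ
  simp only [mem_univ, if_true] at h2
  have h3 : (univ.filter fun c : Q → Bool × Bool => Misses H fun u => separateBits (c u)).card ≤
      (univ.filter fun b : Q × Bool → Bool => ∀ S ∈ H, ¬ ∀ u ∈ S, b u = true).card := by
    refine card_le_card_of_injOn (fun c l => separateBits (c l.1) l.2) ?_ ?_
    · intro c hc
      simpa [Misses] using hc
    · intro c _ c' _ h
      funext u
      have ht := congrFun h (u, true)
      have hf := congrFun h (u, false)
      simp only [separateBits, if_true, Bool.false_eq_true, if_false] at ht hf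
      exact Prod.ext ht hf
  have h4 : (univ.filter fun y : Q → Bool => ∀ S ∈ H, ¬ ∀ l ∈ S, y l.1 = l.2).card *
      2 ^ Fintype.card Q ≤
      (univ.filter fun c : Q → Bool × Bool => Misses H fun u => exclusiveBits (c u)).card := by
    have h5 : Fintype.card (Q → Bool) = 2 ^ Fintype.card Q := by simp
    rw [← h5, ← card_univ, ← card_product]
    refine card_le_card_of_injOn (fun p u => (p.1 u, p.2 u)) ?_ ?_
    · rintro ⟨y, y'⟩ hy
      simp only [coe_product, coe_filter, mem_univ, true_and, coe_univ, Set.mem_prod,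
        Set.mem_ofPred_eq, Set.mem_univ, and_true] at hy
      simpa [Misses, exclusiveBits] using hy
    · rintro ⟨y, y'⟩ _ ⟨x, x'⟩ _ h
      have h' := fun u => congrFun h u
      simp only [Prod.mk.injEq] at h'
      exact Prod.ext (funext fun u => (h' u).1) (funext fun u => (h' u).2)
  have h6 : ((univ.filter fun y : Q → Bool => ∀ S ∈ H, ¬ ∀ l ∈ S, y l.1 = l.2).card : ℝ) *
      2 ^ Fintype.card Q ≤ 2 * Real.exp (-2) ^ T * 2 ^ Fintype.card Q * 2 ^ Fintype.card Q := by
    refine le_trans ?_ (h1.trans (le_of_eq ?_))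
    · exact_mod_cast h4.trans (h2.trans h3)
    · rw [Fintype.card_prod, Fintype.card_bool, mul_two, pow_add]; ring
  exact le_of_mul_le_mul_right h6 (by positivity)

end Exclusive

/-! ### Handling sets -/

section Handling

variable {X U : Type*} [DecidableEq U]

/-- The link of `γ` in the family of the sets `g x` with `x ∈ A`. -/
def link (g : X → Finset U) (A : Finset X) (γ : Finset U) : Finset (Finset U) :=
  (A.filter fun x => γ ⊆ g x).image fun x => g x \ γ

open Classical in
/-- The set `γ` handles the point `x`: it is contained in `g x`, and its link among the points that
come no later than `x` in the order given by `a` is not small. -/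
def Handles (r : ℝ) (g : X → Finset U) (A : Finset X) (a : X → ℝ) (γ : Finset U) (x : X) : Prop :=
  γ ⊆ g x ∧ ¬ IsSmall r (1 / 2) (link g (A.filter fun x' => a x' ≤ a x) γ)

lemma cost_biUnion_le {ι : Type*} [DecidableEq ι] {r : ℝ} (hr : 0 < r) (s : Finset ι)
    (K : ι → Finset (Finset U)) : cost r (s.biUnion K) ≤ ∑ i ∈ s, cost r (K i) := by
  induction s using Finset.induction_on with
  | empty => simp [cost]
  | insert i s hi ih =>
    rw [biUnion_insert, sum_insert hi]
    exact (cost_union_le hr _ _).trans (by linarith)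

variable [Fintype U] {r : ℝ} (g : X → Finset U) (A : Finset X) (a : X → ℝ)

/-- The supersets of `γ` suffice to handle the points above `γ` at a cost of at most twice that of
`γ`: the points not handled by `γ` itself have a cheap cover of their link, whose members are added
to `γ` before going on recursively. -/
lemma exists_handling_family (hr : 0 < r) (γ : Finset U) :
    ∃ K : Finset (Finset U), (∀ γ' ∈ K, γ ⊆ γ') ∧
      (∀ x ∈ A, γ ⊆ g x → ∃ γ' ∈ K, Handles r g A a γ' x) ∧
      cost r K ≤ 2 * r⁻¹ ^ γ.card := by
  classical
  induction hk : Fintype.card U - γ.card using Nat.strong_induction_on generalizing γ with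
  | _ k ih =>
  subst hk
  have hpos : 0 < r⁻¹ ^ γ.card := by positivity
  set X₀ := A.filter fun x => γ ⊆ g x ∧ ¬ Handles r g A a γ x with hX₀
  rcases X₀.eq_empty_or_nonempty with hem | hne
  · refine ⟨{γ}, by simp, fun x hx hγ => ⟨γ, by simp, ?_⟩, by
      rw [cost, sum_singleton]; linarith⟩
    by_contra hcon
    have : x ∈ X₀ := mem_filter.2 ⟨hx, hγ, hcon⟩
    rw [hem] at this
    simp at this
  · obtain ⟨x₀, hx₀, hmax⟩ := exists_max_image X₀ a hne
    have hsmall : IsSmall r (1 / 2) (link g (A.filter fun x' => a x' ≤ a x₀) γ) := by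
      have := (mem_filter.1 hx₀).2
      by_contra hcon
      exact this.2 ⟨this.1, hcon⟩
    obtain ⟨𝒰, hcov, hcost⟩ := hsmall
    set 𝒱 := 𝒰.filter (Disjoint γ) with h𝒱
    have hVcost : cost r 𝒱 ≤ 1 / 2 := (cost_mono hr (filter_subset _ _)).trans hcost
    have hVne : ∀ S ∈ 𝒱, S.Nonempty := by
      intro S hS
      rw [nonempty_iff_ne_empty]
      rintro rfl
      have : cost r {∅} ≤ cost r 𝒱 := cost_mono hr (singleton_subset_iff.2 hS)
      simp only [cost, sum_singleton, card_empty, pow_zero] at this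
      unfold cost at hVcost
      linarith
    have hcard : ∀ S ∈ 𝒱, (γ ∪ S).card = γ.card + S.card := fun S hS =>
      card_union_of_disjoint (mem_filter.1 hS).2
    have hstep : ∀ S : Finset U, ∃ K : Finset (Finset U), S ∈ 𝒱 → (∀ γ' ∈ K, γ ∪ S ⊆ γ') ∧
        (∀ x ∈ A, γ ∪ S ⊆ g x → ∃ γ' ∈ K, Handles r g A a γ' x) ∧
        cost r K ≤ 2 * r⁻¹ ^ (γ ∪ S).card := by
      intro S
      by_cases hS : S ∈ 𝒱
      · have h1 := card_le_univ (γ ∪ S)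
        have h2 := hcard S hS
        have h3 := (hVne S hS).card_pos
        obtain ⟨K, hK⟩ := ih _ (by omega) (γ ∪ S) rfl
        exact ⟨K, fun _ => hK⟩
      · exact ⟨∅, fun h => absurd h hS⟩
    choose K hK using hstep
    refine ⟨{γ} ∪ 𝒱.biUnion K, ?_, ?_, ?_⟩
    · intro γ' hγ'
      rcases mem_union.1 hγ' with h | h
      · rw [mem_singleton.1 h]
      · obtain ⟨S, hS, h⟩ := mem_biUnion.1 h
        exact subset_union_left.trans ((hK S hS).1 γ' h)
    · intro x hx hγx
      by_cases hh : Handles r g A a γ x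
      · exact ⟨γ, by simp, hh⟩
      · have hxX : x ∈ X₀ := mem_filter.2 ⟨hx, hγx, hh⟩
        have hmem : g x \ γ ∈ link g (A.filter fun x' => a x' ≤ a x₀) γ :=
          mem_image.2 ⟨x, mem_filter.2 ⟨mem_filter.2 ⟨hx, hmax x hxX⟩, hγx⟩, rfl⟩
        obtain ⟨S, hS, hSx⟩ := hcov _ hmem
        have hSV : S ∈ 𝒱 := mem_filter.2 ⟨hS, disjoint_sdiff.mono_right hSx⟩
        obtain ⟨γ', hγ', h'⟩ := (hK S hSV).2.1 x hx
          (union_subset hγx (hSx.trans sdiff_subset))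
        exact ⟨γ', mem_union_right _ (mem_biUnion.2 ⟨S, hSV, hγ'⟩), h'⟩
    · calc cost r ({γ} ∪ 𝒱.biUnion K) ≤ cost r {γ} + cost r (𝒱.biUnion K) := cost_union_le hr _ _
        _ ≤ r⁻¹ ^ γ.card + ∑ S ∈ 𝒱, 2 * (r⁻¹ ^ γ.card * r⁻¹ ^ S.card) := by
          refine add_le_add (by simp [cost]) ((cost_biUnion_le hr _ _).trans ?_)
          refine sum_le_sum fun S hS => ?_
          rw [← pow_add, ← hcard S hS]
          exact (hK S hS).2.2
        _ = r⁻¹ ^ γ.card + 2 * r⁻¹ ^ γ.card * cost r 𝒱 := by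
          rw [cost, mul_sum]
          congr 1
          exact sum_congr rfl fun _ _ => by ring
        _ ≤ 2 * r⁻¹ ^ γ.card := by nlinarith

/-- A cheapest family that handles all points. It costs at most `2 * r⁻ᵏ` above each set of size
`k`, as otherwise this part of it could be replaced with a cheaper one. -/
lemma exists_hereditary_handling_family (hr : 0 < r) :
    ∃ M : Finset (Finset U), (∀ x ∈ A, ∃ γ ∈ M, Handles r g A a γ x) ∧
      ∀ κ : Finset U, cost r (M.filter fun γ => κ ⊆ γ) ≤ 2 * r⁻¹ ^ κ.card := by
  classical
  obtain ⟨M, hM, hmin⟩ := exists_min_image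
    (univ.filter fun M : Finset (Finset U) => ∀ x ∈ A, ∃ γ ∈ M, Handles r g A a γ x) (cost r) (by
      obtain ⟨K, -, h, -⟩ := exists_handling_family g A a hr ∅
      exact ⟨K, mem_filter.2 ⟨mem_univ _, fun x hx => h x hx (empty_subset _)⟩⟩)
  rw [mem_filter] at hM
  refine ⟨M, hM.2, fun κ => ?_⟩
  obtain ⟨K, -, hK, hKc⟩ := exists_handling_family g A a hr κ
  have h1 := hmin ((M.filter fun γ => ¬ κ ⊆ γ) ∪ K) (mem_filter.2 ⟨mem_univ _, fun x hx => by
    obtain ⟨γ, hγ, hh⟩ := hM.2 x hx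
    by_cases hκ : κ ⊆ γ
    · obtain ⟨γ', hγ', h'⟩ := hK x hx (hκ.trans hh.1)
      exact ⟨γ', mem_union_right _ hγ', h'⟩
    · exact ⟨γ, mem_union_left _ (mem_filter.2 ⟨hγ, hκ⟩), hh⟩⟩)
  have h2 := cost_union_le hr (M.filter fun γ => ¬ κ ⊆ γ) K
  have h3 : cost r M = cost r (M.filter fun γ => κ ⊆ γ) + cost r (M.filter fun γ => ¬ κ ⊆ γ) :=
    (sum_filter_add_sum_filter_not _ _ _).symm
  linarith

omit [Fintype U] in
/-- The cost of all unions of a member of `M₀` and a member of `M₁`, for a doubled parameter that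
pays for the choice of the intersection. -/
lemma sum_union_cost_le (hr : 0 < r) {M₀ M₁ : Finset (Finset U)}
    (h₀ : cost r M₀ ≤ 2)
    (h₁ : ∀ κ : Finset U, cost r (M₁.filter fun γ => κ ⊆ γ) ≤ 2 * r⁻¹ ^ κ.card) :
    ∑ p ∈ M₀ ×ˢ M₁, (2 * r)⁻¹ ^ (p.1 ∪ p.2).card ≤ 4 := by
  have hrr : (2 * r)⁻¹ ≤ r⁻¹ := inv_anti₀ hr (by linarith)
  have key : ∀ β₀ ∈ M₀, ∑ β₁ ∈ M₁, (2 * r)⁻¹ ^ (β₀ ∪ β₁).card ≤ 2 * r⁻¹ ^ β₀.card := by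
    intro β₀ _
    calc ∑ β₁ ∈ M₁, (2 * r)⁻¹ ^ (β₀ ∪ β₁).card
        = ∑ κ ∈ β₀.powerset, ∑ β₁ ∈ M₁.filter fun β₁ => β₀ ∩ β₁ = κ,
            (2 * r)⁻¹ ^ (β₀ ∪ β₁).card :=
          (sum_fiberwise_of_maps_to (fun β₁ _ => mem_powerset.2 inter_subset_left) _).symm
      _ ≤ ∑ κ ∈ β₀.powerset, (2 * r)⁻¹ ^ β₀.card * 2 := by
          refine sum_le_sum fun κ _ => ?_
          calc ∑ β₁ ∈ M₁.filter fun β₁ => β₀ ∩ β₁ = κ, (2 * r)⁻¹ ^ (β₀ ∪ β₁).card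
              ≤ ∑ β₁ ∈ M₁.filter fun β₁ => β₀ ∩ β₁ = κ,
                  (2 * r)⁻¹ ^ β₀.card * (r ^ κ.card * r⁻¹ ^ β₁.card) := by
                refine sum_le_sum fun β₁ hβ₁ => ?_
                obtain ⟨_, rfl⟩ := mem_filter.1 hβ₁
                have hc : (β₀ ∪ β₁).card = β₀.card + (β₁ \ β₀).card := by
                  rw [← union_sdiff_self_eq_union, card_union_of_disjoint disjoint_sdiff]
                have hc' : β₁.card = (β₀ ∩ β₁).card + (β₁ \ β₀).card := by
                  rw [inter_comm, card_inter_add_card_sdiff]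
                rw [hc, pow_add]
                refine mul_le_mul_of_nonneg_left ?_ (by positivity)
                rw [hc', pow_add, ← mul_assoc, ← mul_pow, mul_inv_cancel₀ hr.ne', one_pow, one_mul]
                exact pow_le_pow_left₀ (by positivity) hrr _
            _ = (2 * r)⁻¹ ^ β₀.card * (r ^ κ.card * cost r (M₁.filter fun β₁ => β₀ ∩ β₁ = κ)) := by
                rw [cost, mul_sum, mul_sum]
            _ ≤ (2 * r)⁻¹ ^ β₀.card * (r ^ κ.card * (2 * r⁻¹ ^ κ.card)) := by
                refine mul_le_mul_of_nonneg_left (mul_le_mul_of_nonneg_left ?_ (by positivity))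
                  (by positivity)
                refine (cost_mono hr fun β₁ hβ₁ => ?_).trans (h₁ κ)
                obtain ⟨h, rfl⟩ := mem_filter.1 hβ₁
                exact mem_filter.2 ⟨h, inter_subset_right⟩
            _ = (2 * r)⁻¹ ^ β₀.card * 2 := by
                have : r ^ κ.card * r⁻¹ ^ κ.card = 1 := by
                  rw [← mul_pow, mul_inv_cancel₀ hr.ne', one_pow]
                linear_combination (2 * r)⁻¹ ^ β₀.card * 2 * this
      _ = 2 * r⁻¹ ^ β₀.card := by
          rw [sum_const, card_powerset, nsmul_eq_mul, mul_inv, mul_pow]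
          push_cast
          have : (2 : ℝ) ^ β₀.card * 2⁻¹ ^ β₀.card = 1 := by
            rw [← mul_pow]; norm_num
          linear_combination 2 * r⁻¹ ^ β₀.card * this
  rw [sum_product]
  calc _ ≤ ∑ β₀ ∈ M₀, 2 * r⁻¹ ^ β₀.card := sum_le_sum key
    _ = 2 * cost r M₀ := by rw [cost, mul_sum]
    _ ≤ 4 := by linarith

end Handling

/-! ### Tree-like resolution -/

section Resolution

variable {n : ℕ}

/-- The clause `C` has a tree-like resolution derivation from `F` of width at most `w` and depth at
most `h`. -/
inductive Derivable (F : CNF n) (w : ℕ) : ℕ → Clause n → Prop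
  | initial {h : ℕ} {C : Clause n} (hC : C ∈ F) (hw : C.width ≤ w) : Derivable F w h C
  | resolve {h : ℕ} {A B E : Clause n} (hA : Derivable F w h A) (hB : Derivable F w h B)
      (hE : IsResolvent A B E) (hw : E.width ≤ w) : Derivable F w (h + 1) E

lemma Derivable.mono {F : CNF n} {w h h' : ℕ} {C : Clause n} (hC : Derivable F w h C)
    (hh : h ≤ h') : Derivable F w h' C := by
  induction hC generalizing h' with
  | initial hC hw => exact .initial hC hw
  | resolve _ _ hE hw ihA ihB =>
    obtain ⟨k, rfl⟩ : ∃ k, h' = k + 1 := ⟨h' - 1, by omega⟩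
    exact .resolve (ihA (by omega)) (ihB (by omega)) hE hw

/-- A derivation written as a sequence of clauses, with a rank function that increases along the
edges and is bounded by the depth. -/
lemma Derivable.exists_sequence {F : CNF n} {w h : ℕ} {C : Clause n} (hC : Derivable F w h C) :
    ∃ (N : ℕ) (c : ℕ → Clause n) (rk : ℕ → ℕ), c N = C ∧ ∀ i ≤ N, (c i).width ≤ w ∧ rk i ≤ h ∧
      (c i ∈ F ∨ ∃ j < i, ∃ k < i, rk j < rk i ∧ rk k < rk i ∧
        IsResolvent (c j) (c k) (c i)) := by
  induction hC with
  | initial hC hw =>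
    exact ⟨0, fun _ => _, fun _ => 0, rfl, fun i _ => ⟨hw, Nat.zero_le _, Or.inl hC⟩⟩
  | @resolve h A B E hA hB hE hw ihA ihB =>
    obtain ⟨N₁, c₁, rk₁, hc₁, h₁⟩ := ihA
    obtain ⟨N₂, c₂, rk₂, hc₂, h₂⟩ := ihB
    let c : ℕ → Clause n := fun i =>
      if i ≤ N₁ then c₁ i else if i ≤ N₁ + 1 + N₂ then c₂ (i - (N₁ + 1)) else E
    let rk : ℕ → ℕ := fun i =>
      if i ≤ N₁ then rk₁ i else if i ≤ N₁ + 1 + N₂ then rk₂ (i - (N₁ + 1)) else h + 1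
    have c1 : ∀ i ≤ N₁, c i = c₁ i ∧ rk i = rk₁ i := fun i hi => by simp [c, rk, hi]
    have c2 : ∀ i ≤ N₂, c (N₁ + 1 + i) = c₂ i ∧ rk (N₁ + 1 + i) = rk₂ i := by
      intro i hi
      have e1 : ¬ N₁ + 1 + i ≤ N₁ := by omega
      have e2 : N₁ + 1 + i ≤ N₁ + 1 + N₂ := by omega
      simp only [c, rk, e1, e2, if_true, if_false, Nat.add_sub_cancel_left, and_self]
    have c3 : c (N₁ + 1 + N₂ + 1) = E ∧ rk (N₁ + 1 + N₂ + 1) = h + 1 := by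
      have e1 : ¬ N₁ + 1 + N₂ + 1 ≤ N₁ := by omega
      have e2 : ¬ N₁ + 1 + N₂ + 1 ≤ N₁ + 1 + N₂ := by omega
      simp only [c, rk, e1, e2, if_false, and_self]
    refine ⟨N₁ + 1 + N₂ + 1, c, rk, c3.1, fun i hi => ?_⟩
    rcases le_or_gt i N₁ with hi1 | hi1
    · obtain ⟨hw1, hr1, hd⟩ := h₁ i hi1
      rw [(c1 i hi1).1, (c1 i hi1).2]
      refine ⟨hw1, hr1.trans (Nat.le_succ _), hd.imp id ?_⟩
      rintro ⟨j, hj, k, hk, hjr, hkr, hres⟩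
      refine ⟨j, hj, k, hk, ?_⟩
      rw [(c1 j (by omega)).1, (c1 j (by omega)).2, (c1 k (by omega)).1, (c1 k (by omega)).2]
      exact ⟨hjr, hkr, hres⟩
    · rcases le_or_gt i (N₁ + 1 + N₂) with hi2 | hi2
      · obtain ⟨i, rfl⟩ : ∃ i', i = N₁ + 1 + i' := ⟨i - (N₁ + 1), by omega⟩
        have hi3 : i ≤ N₂ := by omega
        obtain ⟨hw1, hr1, hd⟩ := h₂ i hi3
        rw [(c2 i hi3).1, (c2 i hi3).2]
        refine ⟨hw1, hr1.trans (Nat.le_succ _), hd.imp id ?_⟩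
        rintro ⟨j, hj, k, hk, hjr, hkr, hres⟩
        refine ⟨N₁ + 1 + j, by omega, N₁ + 1 + k, by omega, ?_⟩
        rw [(c2 j (by omega)).1, (c2 j (by omega)).2, (c2 k (by omega)).1, (c2 k (by omega)).2]
        exact ⟨hjr, hkr, hres⟩
      · obtain rfl : i = N₁ + 1 + N₂ + 1 := by omega
        rw [c3.1, c3.2]
        refine ⟨hw, le_rfl, Or.inr ⟨N₁, by omega, N₁ + 1 + N₂, by omega, ?_⟩⟩
        rw [(c1 N₁ le_rfl).1, (c1 N₁ le_rfl).2, (c2 N₂ le_rfl).1, (c2 N₂ le_rfl).2, hc₁, hc₂]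
        exact ⟨Nat.lt_succ_of_le (h₁ N₁ le_rfl).2.1, Nat.lt_succ_of_le (h₂ N₂ le_rfl).2.1, hE⟩

lemma Derivable.exists_refutation {F : CNF n} {w h : ℕ} {C : Clause n} (hC : Derivable F w h C)
    (hC0 : C.lits = ∅) : ∃ P : Refutation F, P.width ≤ w ∧ P.depth ≤ (h : ℕ∞) := by
  classical
  obtain ⟨N, c, rk, hcN, hc⟩ := hC.exists_sequence
  let Prem : Fin (N + 1) → Fin (N + 1) × Fin (N + 1) → Prop := fun i p =>
    p.1 < i ∧ p.2 < i ∧ rk p.1 < rk i ∧ rk p.2 < rk i ∧ IsResolvent (c p.1) (c p.2) (c i)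
  let prem : Fin (N + 1) → Option (Fin (N + 1) × Fin (N + 1)) := fun i =>
    if hi : ∃ p, Prem i p then some hi.choose else none
  have hprem : ∀ i p, prem i = some p → Prem i p := by
    intro i p hip
    by_cases hi : ∃ p, Prem i p
    · rw [show prem i = some hi.choose from dif_pos hi, Option.some.injEq] at hip
      exact hip ▸ hi.choose_spec
    · rw [show prem i = none from dif_neg hi] at hip
      cases hip
  let P : Refutation F :=
    { s := N
      clause := fun i => c i
      premises := prem
      initial := by
        intro i hi
        rcases (hc i (by omega)).2.2 with h | ⟨j, hj, k, hk, hjr, hkr, hres⟩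
        · exact h
        · have : ∃ p, Prem i p :=
            ⟨(⟨j, by omega⟩, ⟨k, by omega⟩), hj, hk, hjr, hkr, hres⟩
          rw [show prem i = some this.choose from dif_pos this] at hi
          cases hi
      derived := by
        intro i j k hi
        obtain ⟨h1, h2, _, _, h3⟩ := hprem i _ hi
        exact ⟨h1, h2, h3⟩
      last_empty := by simp only [Fin.val_last, hcN, hC0] }
  refine ⟨P, Finset.sup_le fun i _ => (hc i (by have := i.2; simp only [P] at this; omega)).1,
    iSup_le fun p => ?_⟩
  have hedge : ∀ u v, P.Edge u v → rk u < rk v := by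
    rintro u v ⟨j, k, hv, hu⟩
    obtain ⟨-, -, h1, h2, -⟩ := hprem v _ hv
    rcases hu with rfl | rfl
    exacts [h1, h2]
  have hpath : ∀ i : ℕ, ∀ hi : i < p.length + 1, i ≤ rk (p ⟨i, hi⟩) := by
    intro i
    induction i with
    | zero => exact fun _ => Nat.zero_le _
    | succ i ih =>
      intro hi
      have h1 := ih (by omega)
      have h2 := hedge _ _ (p.step ⟨i, by omega⟩)
      exact Nat.lt_of_le_of_lt h1 h2
  have h1 := hpath p.length (by omega)
  have h2 := (hc (p ⟨p.length, by omega⟩) (by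
    have := (p ⟨p.length, by omega⟩).2; simp only [P] at this; omega)).2.1
  exact_mod_cast h1.trans h2

/-- Some clause all of whose literals are in `Q` is derivable. -/
def DerivesWithin (F : CNF n) (w h : ℕ) (Q : Finset (Literal n)) : Prop :=
  ∃ C, Derivable F w h C ∧ C.lits ⊆ Q

lemma DerivesWithin.mono {F : CNF n} {w h h' : ℕ} {Q Q' : Finset (Literal n)}
    (hQ : DerivesWithin F w h Q) (hh : h ≤ h') (hQ' : Q ⊆ Q') : DerivesWithin F w h' Q' := by
  obtain ⟨C, hC, hCQ⟩ := hQ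
  exact ⟨C, hC.mono hh, hCQ.trans hQ'⟩

/-- A derivation step that queries the variable `i`. -/
lemma DerivesWithin.query {F : CNF n} {w h : ℕ} {Q : Finset (Literal n)}
    (hQ : ∀ k ∈ Q, ∀ l ∈ Q, k.1 = l.1 → k = l) (hw : Q.card ≤ w) (i : Fin n)
    (h1 : DerivesWithin F w h (insert (i, true) Q))
    (h0 : DerivesWithin F w h (insert (i, false) Q)) : DerivesWithin F w (h + 1) Q := by
  obtain ⟨A, hA, hAQ⟩ := h1
  obtain ⟨B, hB, hBQ⟩ := h0
  by_cases hAi : (i, true) ∈ A.lits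
  · by_cases hBi : (i, false) ∈ B.lits
    · have hsub : A.lits.erase (i, true) ∪ B.lits.erase (i, false) ⊆ Q :=
        union_subset (subset_insert_iff.1 hAQ) (subset_insert_iff.1 hBQ)
      exact ⟨⟨_, fun k hk l hl => hQ k (hsub hk) l (hsub hl)⟩,
        .resolve hA hB ⟨i, hAi, hBi, rfl⟩ ((card_le_card hsub).trans hw), hsub⟩
    · exact ⟨B, hB.mono (Nat.le_succ _), (subset_insert_iff_of_notMem hBi).1 hBQ⟩
  · exact ⟨A, hA.mono (Nat.le_succ _), (subset_insert_iff_of_notMem hAi).1 hAQ⟩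

/-- The literals over the variables in `I` that are falsified by `z`. -/
def falseLits (z : Fin n → Bool) (I : Finset (Fin n)) : Finset (Literal n) :=
  I.image fun i => (i, !z i)

lemma mem_falseLits {z : Fin n → Bool} {I : Finset (Fin n)} {l : Literal n} :
    l ∈ falseLits z I ↔ l.1 ∈ I ∧ z l.1 ≠ l.2 := by
  obtain ⟨j, b⟩ := l
  simp only [falseLits, mem_image, Prod.mk.injEq]
  constructor
  · rintro ⟨i, hi, rfl, rfl⟩
    exact ⟨hi, by simp⟩
  · rintro ⟨hj, hb⟩
    exact ⟨j, hj, rfl, by cases h : z j <;> cases b <;> simp_all⟩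

lemma falseLits_mono (z : Fin n → Bool) {I J : Finset (Fin n)} (h : I ⊆ J) :
    falseLits z I ⊆ falseLits z J :=
  image_subset_image h

lemma card_falseLits_le (z : Fin n → Bool) (I : Finset (Fin n)) :
    (falseLits z I).card ≤ I.card :=
  card_image_le

/-- If every assignment that agrees with `ρ` on `G` falsifies a derivable clause over the variables
in `I`, then querying all variables of `I` outside `G` derives a clause over `I ∩ G` that is
falsified by `ρ`. No intermediate clause uses variables outside `I`. -/
lemma DerivesWithin.query_all {F : CNF n} {w h : ℕ} {I G : Finset (Fin n)} {ρ : Fin n → Bool}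
    (hI : I.card ≤ w)
    (hz : ∀ z : Fin n → Bool, (∀ i ∈ G, z i = ρ i) → DerivesWithin F w h (falseLits z I)) :
    DerivesWithin F w (h + w) (falseLits ρ G) := by
  have key : ∀ J : Finset (Fin n), Disjoint J G → J ⊆ I → ∀ z : Fin n → Bool,
      (∀ i ∈ G, z i = ρ i) → DerivesWithin F w (h + J.card) (falseLits z (I \ J)) := by
    intro J
    induction J using Finset.induction_on with
    | empty => intro _ _ z hzG; simpa using hz z hzG
    | insert j J hj ih =>
      intro hJG hJI z hzG
      rw [disjoint_insert_left] at hJG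
      rw [insert_subset_iff] at hJI
      have hjd : I \ J = insert j (I \ insert j J) := by
        ext i
        by_cases hij : i = j
        · subst hij; simp [hj, hJI.1]
        · simp [hij]
      have hb : ∀ b, DerivesWithin F w (h + J.card)
          (insert (j, b) (falseLits z (I \ insert j J))) := by
        intro b
        have h1 := ih hJG.2 hJI.2 (Function.update z j (!b)) (fun i hi => by
          have hij : i ≠ j := by
            rintro rfl
            exact hJG.1 hi
          rw [Function.update_of_ne hij, hzG i hi])
        refine h1.mono le_rfl fun l hl => ?_
        rw [mem_falseLits] at hl
        rw [mem_insert, mem_falseLits]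
        by_cases hlj : l.1 = j
        · left
          have := hl.2
          rw [hlj, Function.update_self] at this
          exact Prod.ext hlj (by cases b <;> cases h : l.2 <;> simp_all)
        · right
          rw [Function.update_of_ne hlj, hjd] at hl
          exact ⟨(mem_insert.1 hl.1).resolve_left hlj, hl.2⟩
      rw [card_insert_of_notMem hj, ← add_assoc]
      refine DerivesWithin.query ?_ ?_ j (hb true) (hb false)
      · intro k hk l hl hkl
        rw [mem_falseLits] at hk hl
        refine Prod.ext hkl ?_
        have h1 := hk.2
        have h2 := hl.2
        rw [hkl] at h1
        cases h3 : z l.1 <;> cases h4 : k.2 <;> cases h5 : l.2 <;> simp_all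
      · exact (card_falseLits_le _ _).trans ((card_le_card sdiff_subset).trans hI)
  have h1 := key (I \ G) sdiff_disjoint sdiff_subset ρ fun _ _ => rfl
  refine h1.mono ?_ (falseLits_mono _ ?_)
  · have := card_le_card (sdiff_subset : I \ G ⊆ I)
    omega
  · intro i hi
    rw [mem_sdiff, mem_sdiff] at hi
    by_contra hG
    exact hi.2 ⟨hi.1, hG⟩

end Resolution

/-! ### Triangles over the indexing gadget -/

section Index

variable {n m : ℕ}

/-- The graph of `x`, as a set of positions in the input of the second party. -/
def graphSet (x : Fin n → Fin m) : Finset (Fin n × Fin m) :=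
  univ.image fun i => (i, x i)

lemma mem_graphSet {x : Fin n → Fin m} {p : Fin n × Fin m} : p ∈ graphSet x ↔ x p.1 = p.2 := by
  simp only [graphSet, mem_image, mem_univ, true_and]
  exact ⟨by rintro ⟨i, rfl⟩; rfl, fun h => ⟨p.1, Prod.ext rfl h⟩⟩

lemma card_graphSet_le (x : Fin n → Fin m) : (graphSet x).card ≤ n :=
  card_image_le.trans (by simp)

lemma card_image_fst_of_subset_graphSet {γ : Finset (Fin n × Fin m)} {x : Fin n → Fin m}
    (h : γ ⊆ graphSet x) : (γ.image Prod.fst).card = γ.card := by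
  refine card_image_of_injOn fun p hp q hq hpq => Prod.ext hpq ?_
  rw [← mem_graphSet.1 (h hp), ← mem_graphSet.1 (h hq), hpq]

lemma card_filter_subset_graphSet_le (hm : 0 < m) (γ : Finset (Fin n × Fin m)) :
    ((univ.filter fun x : Fin n → Fin m => γ ⊆ graphSet x).card : ℝ) ≤
      (m : ℝ) ^ n * (m : ℝ)⁻¹ ^ γ.card := by
  classical
  rcases (univ.filter fun x : Fin n → Fin m => γ ⊆ graphSet x).eq_empty_or_nonempty
    with he | ⟨x, hx⟩
  · rw [he]; simp only [card_empty, Nat.cast_zero]; positivity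
  have hx' : γ ⊆ graphSet x := (mem_filter.1 hx).2
  have hsub : (univ.filter fun x : Fin n → Fin m => γ ⊆ graphSet x) ⊆
      Fintype.piFinset fun i => if i ∈ γ.image Prod.fst then {x i} else univ := by
    intro x' hx2
    rw [Fintype.mem_piFinset]
    intro i
    split_ifs with hi
    · obtain ⟨p, hp, rfl⟩ := mem_image.1 hi
      rw [mem_singleton, mem_graphSet.1 ((mem_filter.1 hx2).2 hp), mem_graphSet.1 (hx' hp)]
    · exact mem_univ _
  have hcard : (Fintype.piFinset fun i => if i ∈ γ.image Prod.fst then {x i} else univ).card *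
      m ^ γ.card = m ^ n := by
    have h4 : ∀ i, (if i ∈ γ.image Prod.fst then ({x i} : Finset (Fin m)) else univ).card =
        if i ∈ γ.image Prod.fst then 1 else m := by
      intro i
      split_ifs <;> simp
    rw [Fintype.card_piFinset, prod_congr rfl fun i _ => h4 i, prod_ite, prod_const_one, one_mul,
      prod_const, ← pow_add, ← card_image_fst_of_subset_graphSet hx']
    congr 1
    have h5 : (univ.filter fun i => i ∉ γ.image Prod.fst) = (γ.image Prod.fst)ᶜ := by
      ext; simp
    rw [h5, card_compl, Fintype.card_fin]
    have := card_le_univ (γ.image Prod.fst)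
    rw [Fintype.card_fin] at this
    omega
  have hm' : (m : ℝ) ≠ 0 := by positivity
  rw [inv_pow, ← div_eq_mul_inv, le_div_iff₀ (by positivity)]
  exact_mod_cast (Nat.mul_le_mul_right _ (card_le_card hsub)).trans hcard.le

/-- If each point above `γ` has an answer pattern outside `γ` that no `y ∈ B` attains, and the link
of `γ` is not small, then `B` is tiny: the patterns form a family of sets of literals that is not
small either. -/
lemma card_le_of_missing_patterns {r : ℝ} (hr : 0 < r) {T : ℕ} (hn : 1 ≤ n) (hT : 1 ≤ T)
    (hq : 4 * T * √n ≤ 0.03 * r) (A : Finset (Fin n → Fin m)) (γ : Finset (Fin n × Fin m))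
    (hA : ¬ IsSmall r (1 / 2) (link graphSet A γ)) (B : Finset (Fin n → Fin m → Bool))
    (z : (Fin n → Fin m) → Fin n → Bool)
    (hB : ∀ y ∈ B, ∀ x ∈ A, γ ⊆ graphSet x → ∃ i, (i, x i) ∉ γ ∧ y i (x i) ≠ z x i) :
    (B.card : ℝ) ≤ 2 * Real.exp (-2) ^ T * 2 ^ (n * m) := by
  classical
  let lit : (Fin n → Fin m) → Finset ((Fin n × Fin m) × Bool) := fun x =>
    (graphSet x \ γ).image fun p => (p, z x p.1)
  set H := (A.filter fun x => γ ⊆ graphSet x).image lit with hH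
  have hfst : ∀ x, (lit x).image Prod.fst = graphSet x \ γ := by
    intro x
    simp only [lit, image_image]
    exact image_id
  have hinj : ∀ x, Set.InjOn Prod.fst (lit x : Set ((Fin n × Fin m) × Bool)) := by
    intro x l hl l' hl' hll
    simp only [lit, coe_image, Set.mem_image] at hl hl'
    obtain ⟨p, _, rfl⟩ := hl
    obtain ⟨p', _, rfl⟩ := hl'
    simp only at hll
    rw [hll]
  have h := card_filter_unsatisfied_le hr hn hT hq H ?_ ?_ ?_
  · rw [Fintype.card_prod, Fintype.card_fin, Fintype.card_fin] at h
    refine le_trans (Nat.cast_le.2 ?_) h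
    refine card_le_card_of_injOn (fun y p => y p.1 p.2) ?_ ?_
    · intro y hy
      simp only [coe_filter, mem_univ, true_and, Set.mem_ofPred_eq]
      intro S hS hcon
      obtain ⟨x, hx, rfl⟩ := mem_image.1 hS
      rw [mem_filter] at hx
      obtain ⟨i, hi, hne⟩ := hB y hy x hx.1 hx.2
      refine hne (hcon ((i, x i), z x i) (mem_image.2 ⟨(i, x i), ?_, rfl⟩))
      exact mem_sdiff.2 ⟨mem_graphSet.2 rfl, hi⟩
    · intro y _ y' _ hyy
      funext i j
      exact congrFun hyy (i, j)
  · intro S hS u hu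
    obtain ⟨x, _, rfl⟩ := mem_image.1 hS
    have := hinj x hu.1 hu.2 rfl
    simp at this
  · intro S hS
    obtain ⟨x, _, rfl⟩ := mem_image.1 hS
    exact card_image_le.trans ((card_le_card sdiff_subset).trans (card_graphSet_le x))
  · rintro ⟨𝒰, hcov, hcost⟩
    set 𝒱 : Finset (Finset ((Fin n × Fin m) × Bool)) :=
      𝒰.filter fun S => (S.image Prod.fst).card = S.card with h𝒱
    refine hA ⟨𝒱.image (image Prod.fst), ?_, ?_⟩
    · intro R hR
      obtain ⟨x, hx, rfl⟩ := mem_image.1 hR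
      obtain ⟨S, hS, hSx⟩ := hcov (lit x) (mem_image_of_mem _ hx)
      refine ⟨S.image Prod.fst, mem_image_of_mem _ (mem_filter.2
        ⟨hS, card_image_of_injOn ((hinj x).mono hSx)⟩), ?_⟩
      rw [← hfst]
      exact image_subset_image hSx
    · refine le_trans ?_ hcost
      unfold cost
      calc ∑ R ∈ 𝒱.image (image Prod.fst), r⁻¹ ^ R.card
          ≤ ∑ S ∈ 𝒱, r⁻¹ ^ (S.image Prod.fst).card :=
            sum_image_le_of_nonneg fun _ _ => by positivity
        _ = ∑ S ∈ 𝒱, r⁻¹ ^ S.card :=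
            sum_congr rfl fun S hS => by rw [(mem_filter.1 hS).2]
        _ ≤ _ := sum_le_sum_of_subset_of_nonneg (filter_subset _ _) fun _ _ _ => by positivity

/-- The bits that the gadgets compute from `x` and `y`. -/
def gadgetBits (x : Fin n → Fin m) (y : Fin n → Fin m → Bool) : Fin n → Bool :=
  fun i => y i (x i)

variable {F : CNF n} {w h : ℕ} {r : ℝ} {T : ℕ}

open Classical in
/-- Only few `y` lie in the triangle `a x < b y` for some `x` handled by `γ` without the
corresponding clause over the variables of `γ` being derivable. Among these `y`, take those with
given bits on `γ`, and let `x` belong to the one with the least `b y`. Every point above `γ` that is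
no higher than `x` lies in the triangle together with all these `y`. As the clause is not derivable,
each such point has an answer pattern that none of them attains. -/
lemma card_bad_le (hr : 0 < r) (hn : 1 ≤ n) (hT : 1 ≤ T)
    (hq : 4 * T * √n ≤ 0.03 * r) (A : Finset (Fin n → Fin m)) (B : Finset (Fin n → Fin m → Bool))
    (a : (Fin n → Fin m) → ℝ) (b : (Fin n → Fin m → Bool) → ℝ) (γ : Finset (Fin n × Fin m))
    (hstep : ∀ x ∈ A, ∀ ρ : Fin n → Bool,
      (∀ z : Fin n → Bool, (∀ i ∈ γ.image Prod.fst, z i = ρ i) →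
        ∃ y ∈ B, a x < b y ∧ gadgetBits x y = z) →
      DerivesWithin F w h (falseLits ρ (γ.image Prod.fst))) :
    ((B.filter fun y => ∃ x ∈ A, Handles r graphSet A a γ x ∧ a x < b y ∧
      ¬ DerivesWithin F w h (falseLits (gadgetBits x y) (γ.image Prod.fst))).card : ℝ) ≤
      2 ^ γ.card * (2 * Real.exp (-2) ^ T * 2 ^ (n * m)) := by
  set Bad := B.filter fun y => ∃ x ∈ A, Handles r graphSet A a γ x ∧ a x < b y ∧
      ¬ DerivesWithin F w h (falseLits (gadgetBits x y) (γ.image Prod.fst)) with hBad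
  let key : (Fin n → Fin m → Bool) → (γ → Bool) := fun y p => y p.1.1 p.1.2
  have hfib : ∀ k : γ → Bool, ((Bad.filter fun y => key y = k).card : ℝ) ≤
      2 * Real.exp (-2) ^ T * 2 ^ (n * m) := by
    intro k
    rcases (Bad.filter fun y => key y = k).eq_empty_or_nonempty with he | hne
    · rw [he]; simp only [card_empty, Nat.cast_zero]; positivity
    obtain ⟨y₀, hy₀, hmin⟩ := exists_min_image _ b hne
    obtain ⟨hy₀B, hk₀⟩ := mem_filter.1 hy₀
    obtain ⟨-, x₀, hx₀, hh, hab, hnd⟩ := mem_filter.1 hy₀B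
    have hmiss : ∀ x, ∃ z : Fin n → Bool, x ∈ A →
        (∀ i ∈ γ.image Prod.fst, z i = gadgetBits x₀ y₀ i) ∧
        ∀ y ∈ B, a x < b y → gadgetBits x y ≠ z := by
      intro x
      by_cases hx : x ∈ A
      · have := mt (hstep x hx (gadgetBits x₀ y₀)) hnd
        push Not at this
        obtain ⟨z, hz1, hz2⟩ := this
        exact ⟨z, fun _ => ⟨hz1, hz2⟩⟩
      · exact ⟨fun _ => true, fun h => absurd h hx⟩
    choose z hz using hmiss
    refine card_le_of_missing_patterns hr hn hT hq _ γ hh.2 _ z ?_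
    intro y hy x hx hγx
    obtain ⟨hyBad, hyk⟩ := mem_filter.1 hy
    obtain ⟨hxA, hxa⟩ := mem_filter.1 hx
    have hlt : a x < b y := lt_of_le_of_lt hxa (lt_of_lt_of_le hab (hmin y hy))
    obtain ⟨i, hi⟩ := Function.ne_iff.1 ((hz x hxA).2 y (mem_filter.1 hyBad).1 hlt)
    refine ⟨i, fun hiγ => hi ?_, hi⟩
    rw [(hz x hxA).1 i (mem_image_of_mem Prod.fst hiγ)]
    have h1 : x₀ i = x i := mem_graphSet.1 (hh.1 hiγ)
    have h2 : key y = key y₀ := hyk.trans hk₀.symm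
    have h3 := congrFun h2 ⟨(i, x i), hiγ⟩
    simpa [gadgetBits, h1, key] using h3
  have hsum : Bad.card = ∑ k : γ → Bool, (Bad.filter fun y => key y = k).card :=
    card_eq_sum_card_fiberwise fun _ _ => mem_coe.2 (mem_univ _)
  rw [hsum, Nat.cast_sum]
  refine (sum_le_sum fun k _ => hfib k).trans (le_of_eq ?_)
  rw [sum_const, card_univ, nsmul_eq_mul]
  simp

/-- The treatment of one triangle `a x < b y`: the points of `A` are handled by a hereditarily cheap
family, and after the removal of few `y` the clauses that belong to the handling sets of size at
most `w` are derivable. -/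
lemma exists_handling_of_triangle (hr : 1 ≤ 2 * r) (hn : 1 ≤ n) (hT : 1 ≤ T)
    (hq : 4 * T * √n ≤ 0.03 * r) (A : Finset (Fin n → Fin m)) (B : Finset (Fin n → Fin m → Bool))
    (a : (Fin n → Fin m) → ℝ) (b : (Fin n → Fin m → Bool) → ℝ)
    (hstep : ∀ x ∈ A, ∀ G : Finset (Fin n), G.card ≤ w → ∀ ρ : Fin n → Bool,
      (∀ z : Fin n → Bool, (∀ i ∈ G, z i = ρ i) → ∃ y ∈ B, a x < b y ∧ gadgetBits x y = z) →
      DerivesWithin F w h (falseLits ρ G)) :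
    ∃ (M : Finset (Finset (Fin n × Fin m))) (β : (Fin n → Fin m) → Finset (Fin n × Fin m))
      (B' : Finset (Fin n → Fin m → Bool)), B' ⊆ B ∧
      ((B \ B').card : ℝ) ≤ 2 * (2 * r) ^ w * (2 * Real.exp (-2) ^ T) * 2 ^ (n * m) ∧
      (∀ κ, cost r (M.filter fun γ => κ ⊆ γ) ≤ 2 * r⁻¹ ^ κ.card) ∧
      (∀ x ∈ A, β x ∈ M ∧ β x ⊆ graphSet x) ∧
      ∀ x ∈ A, ∀ y ∈ B', a x < b y → (β x).card ≤ w →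
        DerivesWithin F w h (falseLits (gadgetBits x y) ((β x).image Prod.fst)) := by
  classical
  have hr0 : 0 < r := by linarith
  obtain ⟨M, hM, hher⟩ := exists_hereditary_handling_family graphSet A a hr0
  have hβ : ∀ x, ∃ γ, x ∈ A → γ ∈ M ∧ Handles r graphSet A a γ x := by
    intro x
    by_cases hx : x ∈ A
    · obtain ⟨γ, hγ⟩ := hM x hx
      exact ⟨γ, fun _ => hγ⟩
    · exact ⟨∅, fun h => absurd h hx⟩
  choose β hβ using hβ
  let Bad : Finset (Fin n × Fin m) → Finset (Fin n → Fin m → Bool) := fun γ =>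
    B.filter fun y => ∃ x ∈ A, Handles r graphSet A a γ x ∧ a x < b y ∧
      ¬ DerivesWithin F w h (falseLits (gadgetBits x y) (γ.image Prod.fst))
  set E := (M.filter fun γ => γ.card ≤ w).biUnion Bad with hE
  refine ⟨M, β, B \ E, sdiff_subset, ?_, hher, fun x hx => ⟨(hβ x hx).1, (hβ x hx).2.1⟩, ?_⟩
  · have h1 : B \ (B \ E) ⊆ E := by
      intro y hy
      rw [mem_sdiff, mem_sdiff] at hy
      by_contra hcon
      exact hy.2 ⟨hy.1, hcon⟩
    have h2 : (E.card : ℝ) ≤ ∑ γ ∈ M.filter fun γ => γ.card ≤ w, ((Bad γ).card : ℝ) := by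
      exact_mod_cast card_biUnion_le
    set e : ℝ := 2 * Real.exp (-2) ^ T * 2 ^ (n * m) with he
    have he0 : 0 ≤ e := by positivity
    have h3 : ∀ γ ∈ M.filter fun γ => γ.card ≤ w,
        ((Bad γ).card : ℝ) ≤ r⁻¹ ^ γ.card * ((2 * r) ^ w * e) := by
      intro γ hγ
      have hγw := (mem_filter.1 hγ).2
      refine (card_bad_le hr0 hn hT hq A B a b γ fun x hx ρ =>
        hstep x hx _ (card_image_le.trans hγw) ρ).trans ?_
      refine (mul_le_mul_of_nonneg_right ?_ he0).trans_eq (mul_assoc _ _ _)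
      have h4 : (2 : ℝ) ^ γ.card = r⁻¹ ^ γ.card * (2 * r) ^ γ.card := by
        rw [← mul_pow]
        congr 1
        field_simp
      rw [h4]
      exact mul_le_mul_of_nonneg_left (pow_le_pow_right₀ hr hγw) (by positivity)
    have h5 : cost r (M.filter fun γ => γ.card ≤ w) ≤ 2 := by
      have h6 := hher ∅
      simp only [empty_subset, card_empty, pow_zero, mul_one] at h6
      exact (cost_mono hr0 fun γ hγ => mem_filter.2 ⟨(mem_filter.1 hγ).1, trivial⟩).trans h6
    calc ((B \ (B \ E)).card : ℝ) ≤ E.card := Nat.cast_le.2 (card_le_card h1)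
      _ ≤ ∑ γ ∈ M.filter fun γ => γ.card ≤ w, r⁻¹ ^ γ.card * ((2 * r) ^ w * e) :=
        h2.trans (sum_le_sum h3)
      _ = cost r (M.filter fun γ => γ.card ≤ w) * ((2 * r) ^ w * e) := by
        rw [cost, sum_mul]
      _ ≤ 2 * ((2 * r) ^ w * e) := mul_le_mul_of_nonneg_right h5 (by positivity)
      _ = _ := by rw [he]; ring
  · intro x hx y hy hab hw
    by_contra hcon
    rw [mem_sdiff] at hy
    exact hy.2 (mem_biUnion.2 ⟨β x, mem_filter.2 ⟨(hβ x hx).1, hw⟩,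
      mem_filter.2 ⟨hy.1, x, hx, (hβ x hx).2, hab, hcon⟩⟩)

/-- Few points are handled at two triangles by sets whose union is larger than `w`. -/
lemma card_filter_lt_card_union_le (hr : 0 < r) (hm : 0 < m) (hrm : 2 * r ≤ m)
    (A : Finset (Fin n → Fin m))
    {M₀ M₁ : Finset (Finset (Fin n × Fin m))} {β₀ β₁ : (Fin n → Fin m) → Finset (Fin n × Fin m)}
    (h₀ : ∀ κ, cost r (M₀.filter fun γ => κ ⊆ γ) ≤ 2 * r⁻¹ ^ κ.card)
    (h₁ : ∀ κ, cost r (M₁.filter fun γ => κ ⊆ γ) ≤ 2 * r⁻¹ ^ κ.card)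
    (hβ₀ : ∀ x ∈ A, β₀ x ∈ M₀ ∧ β₀ x ⊆ graphSet x) (hβ₁ : ∀ x ∈ A, β₁ x ∈ M₁ ∧ β₁ x ⊆ graphSet x) :
    ((A.filter fun x => w < (β₀ x ∪ β₁ x).card).card : ℝ) ≤
      4 * (2 * r / m) ^ (w + 1) * (m : ℝ) ^ n := by
  classical
  set P := (M₀ ×ˢ M₁).filter fun p => w < (p.1 ∪ p.2).card with hP
  have hsub : (A.filter fun x => w < (β₀ x ∪ β₁ x).card) ⊆
      P.biUnion fun p => univ.filter fun x : Fin n → Fin m => p.1 ∪ p.2 ⊆ graphSet x := by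
    intro x hx
    obtain ⟨hxA, hw⟩ := mem_filter.1 hx
    exact mem_biUnion.2 ⟨(β₀ x, β₁ x),
      mem_filter.2 ⟨mem_product.2 ⟨(hβ₀ x hxA).1, (hβ₁ x hxA).1⟩, hw⟩,
      mem_filter.2 ⟨mem_univ _, union_subset (hβ₀ x hxA).2 (hβ₁ x hxA).2⟩⟩
  have hm' : (0 : ℝ) < m := by exact_mod_cast hm
  have hM₀ : cost r M₀ ≤ 2 := by
    have h6 := h₀ ∅
    simpa only [empty_subset, card_empty, pow_zero, mul_one, filter_true] using h6
  have hsum := sum_union_cost_le hr hM₀ h₁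
  calc ((A.filter fun x => w < (β₀ x ∪ β₁ x).card).card : ℝ)
      ≤ ∑ p ∈ P, ((univ.filter fun x : Fin n → Fin m => p.1 ∪ p.2 ⊆ graphSet x).card : ℝ) := by
        exact_mod_cast (card_le_card hsub).trans card_biUnion_le
    _ ≤ ∑ p ∈ P, (2 * r)⁻¹ ^ (p.1 ∪ p.2).card * ((2 * r / m) ^ (w + 1) * (m : ℝ) ^ n) := by
        refine sum_le_sum fun p hp => (card_filter_subset_graphSet_le hm _).trans ?_
        have hpw := (mem_filter.1 hp).2
        have h2 : (m : ℝ)⁻¹ ^ (p.1 ∪ p.2).card =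
            (2 * r)⁻¹ ^ (p.1 ∪ p.2).card * (2 * r / m) ^ (p.1 ∪ p.2).card := by
          rw [← mul_pow]
          congr 1
          field_simp
        rw [h2, mul_comm, mul_assoc]
        refine mul_le_mul_of_nonneg_left (mul_le_mul_of_nonneg_right ?_ (by positivity))
          (by positivity)
        exact pow_le_pow_of_le_one (by positivity) ((div_le_one hm').2 hrm) hpw
    _ = (∑ p ∈ P, (2 * r)⁻¹ ^ (p.1 ∪ p.2).card) * ((2 * r / m) ^ (w + 1) * (m : ℝ) ^ n) := by
        rw [sum_mul]
    _ ≤ 4 * ((2 * r / m) ^ (w + 1) * (m : ℝ) ^ n) := by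
        refine mul_le_mul_of_nonneg_right (le_trans ?_ hsum) (by positivity)
        exact sum_le_sum_of_subset_of_nonneg (filter_subset _ _) fun _ _ _ => by positivity
    _ = _ := by ring

lemma not_isSmall_link_empty (hr : 0 < r) (hm : 0 < m) (hrm : 2 * r ≤ m)
    {A : Finset (Fin n → Fin m)} (hA : r / (2 * m) * (m : ℝ) ^ n < A.card) :
    ¬ IsSmall r (1 / 2) (link graphSet A ∅) := by
  classical
  rintro ⟨𝒰, hcov, hcost⟩
  have hm' : (0 : ℝ) < m := by exact_mod_cast hm
  have hsub : A ⊆ 𝒰.biUnion fun S => univ.filter fun x : Fin n → Fin m => S ⊆ graphSet x := by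
    intro x hx
    obtain ⟨S, hS, hSx⟩ := hcov (graphSet x) (mem_image.2
      ⟨x, mem_filter.2 ⟨hx, empty_subset _⟩, sdiff_empty⟩)
    exact mem_biUnion.2 ⟨S, hS, mem_filter.2 ⟨mem_univ _, hSx⟩⟩
  have hne : ∀ S ∈ 𝒰, 1 ≤ S.card := by
    intro S hS
    rw [Nat.one_le_iff_ne_zero, Ne, card_eq_zero]
    rintro rfl
    have : cost r {∅} ≤ cost r 𝒰 := cost_mono hr (singleton_subset_iff.2 hS)
    rw [cost, sum_singleton, card_empty, pow_zero] at this
    linarith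
  have h1 : (A.card : ℝ) ≤ ∑ S ∈ 𝒰, r⁻¹ ^ S.card * (r / m * (m : ℝ) ^ n) := by
    calc (A.card : ℝ) ≤ ∑ S ∈ 𝒰,
          ((univ.filter fun x : Fin n → Fin m => S ⊆ graphSet x).card : ℝ) := by
          exact_mod_cast (card_le_card hsub).trans card_biUnion_le
      _ ≤ _ := by
          refine sum_le_sum fun S hS => (card_filter_subset_graphSet_le hm _).trans ?_
          have h2 : (m : ℝ)⁻¹ ^ S.card = r⁻¹ ^ S.card * (r / m) ^ S.card := by
            rw [← mul_pow]
            congr 1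
            field_simp
          rw [h2, mul_comm, mul_assoc]
          refine mul_le_mul_of_nonneg_left (mul_le_mul_of_nonneg_right ?_ (by positivity))
            (by positivity)
          have h3 : r / m ≤ 1 := (div_le_one hm').2 (by linarith)
          exact (pow_le_pow_of_le_one (by positivity) h3 (hne S hS)).trans (pow_one _).le
  rw [← sum_mul] at h1
  have h4 : cost r 𝒰 * (r / m * (m : ℝ) ^ n) ≤ 1 / 2 * (r / m * (m : ℝ) ^ n) :=
    mul_le_mul_of_nonneg_right hcost (by positivity)
  have h5 : r / (2 * m) * (m : ℝ) ^ n = 1 / 2 * (r / m * (m : ℝ) ^ n) := by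
    field_simp
  unfold cost at h4
  linarith

end Index

/-! ### Triangle-DAGs -/

section Dag

lemma ShapeDAG.exists_height {D O : Type*} {𝓕 : Set (Set D)} {S : D → O → Prop}
    (G : ShapeDAG 𝓕 S) {d : ℕ} (hd : G.depth ≤ (d : ℕ∞)) :
    ∃ ht : G.V → ℕ, (∀ u, ∀ v ∈ G.children u, ht v < ht u) ∧ ht G.root ≤ d := by
  classical
  have := G.fintypeV
  have hwf : WellFounded fun v u => v ∈ G.children u := by
    let R : G.V → G.V → Prop := fun v u => Relation.TransGen (fun a b => b ∈ G.children a) u v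
    have : IsTrans G.V R := ⟨fun _ _ _ h1 h2 => h2.trans h1⟩
    have : Std.Irrefl R := ⟨fun u h => G.acyclic u h⟩
    have : WellFounded R := Finite.wellFounded_of_trans_of_irrefl R
    exact Subrelation.wf (fun h => Relation.TransGen.single h) this
  let ht : G.V → ℕ := hwf.fix fun u rec => (G.children u).attach.sup fun v => rec v.1 v.2 + 1
  have hht : ∀ u, ht u = (G.children u).attach.sup fun v => ht v.1 + 1 := fun u => hwf.fix_eq _ u
  have hpath : ∀ u, ∃ p : Path (fun a b => b ∈ G.children a),
      p.head = u ∧ G.children p.last = ∅ ∧ p.length = ht u := by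
    intro u
    induction u using hwf.induction with
    | _ u ih =>
    rcases (G.children u).eq_empty_or_nonempty with he | hne
    · refine ⟨RelSeries.singleton _ u, rfl, he, ?_⟩
      have h0 : (G.children u).attach = ∅ := attach_eq_empty_iff.2 he
      rw [hht u, h0, sup_empty]
      rfl
    · obtain ⟨v, -, hv⟩ := exists_mem_eq_sup (G.children u).attach (attach_nonempty_iff.2 hne)
        fun v => ht v.1 + 1
      obtain ⟨p, hp1, hp2, hp3⟩ := ih v.1 v.2
      refine ⟨p.cons u (by rw [hp1]; exact v.2), RelSeries.head_cons .., ?_, ?_⟩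
      · rw [RelSeries.last_cons]; exact hp2
      · rw [hht u, hv, ← hp3, RelSeries.cons_length]
  refine ⟨ht, fun u v hv => ?_, ?_⟩
  · rw [hht u]
    exact Nat.lt_of_succ_le (le_sup (f := fun v : G.children u => ht v.1 + 1)
      (mem_attach _ ⟨v, hv⟩))
  · obtain ⟨p, hp1, hp2, hp3⟩ := hpath G.root
    have h1 : ((p.length : ℕ) : ℕ∞) ≤ G.depth :=
      le_iSup (fun p : {p : Path (fun a b => b ∈ G.children a) //
        p.head = G.root ∧ G.children p.last = ∅} => (p.1.length : ℕ∞)) ⟨p, hp1, hp2⟩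
    rw [← hp3]
    exact_mod_cast h1.trans hd

variable {n m w T : ℕ} {F : CNF n} {r : ℝ}

/-- The state after the nodes in `D` have been treated: all but few `x` and `y` are still in the
good sets `A` and `B`, and each node `v ∈ D` has a hereditarily cheap family `M v` with a choice
`β v` of a handling set in it. On the good sets, a point of the triangle at `v` yields the clause
that belongs to its handling set, and a point that attains all answer patterns extending `ρ` within
the triangle yields the clause falsified by `ρ`. -/
def Treated (G : TriangleDAG (compose (Search F) (IND m))) (ht : G.V → ℕ) (w T : ℕ) (r : ℝ)
    (D : Finset G.V) : Prop :=
  ∃ (A : Finset (Fin n → Fin m)) (B : Finset (Fin n → Fin m → Bool))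
    (M : G.V → Finset (Finset (Fin n × Fin m)))
    (β : G.V → (Fin n → Fin m) → Finset (Fin n × Fin m)),
    ((m : ℝ) ^ n - A.card ≤ D.card * (4 * (2 * r / m) ^ (w + 1) * (m : ℝ) ^ n)) ∧
    ((2 : ℝ) ^ (n * m) - B.card ≤
      D.card * (2 * (2 * r) ^ w * (2 * Real.exp (-2) ^ T) * 2 ^ (n * m))) ∧
    (∀ v ∈ D, ∀ κ, cost r ((M v).filter fun γ => κ ⊆ γ) ≤ 2 * r⁻¹ ^ κ.card) ∧
    (∀ v ∈ D, ∀ x ∈ A, β v x ∈ M v ∧ β v x ⊆ graphSet x) ∧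
    (∀ v ∈ D, ∀ x ∈ A, ∀ y ∈ B, (x, y) ∈ G.shape v → (β v x).card ≤ w →
      DerivesWithin F w (ht v * w) (falseLits (gadgetBits x y) ((β v x).image Prod.fst))) ∧
    (∀ v ∈ D, ∀ x ∈ A, ∀ I : Finset (Fin n), I.card ≤ w → ∀ ρ : Fin n → Bool,
      (∀ z : Fin n → Bool, (∀ i ∈ I, z i = ρ i) →
        ∃ y ∈ B, (x, y) ∈ G.shape v ∧ gadgetBits x y = z) →
      DerivesWithin F w (ht v * w) (falseLits ρ I))

/-- At a leaf, a point that attains all answer patterns extending `ρ` forces the literals of the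
clause at the leaf to be falsified by `ρ`. -/
lemma derivesWithin_of_leaf {C : Clause n} (hC : C ∈ F) {h : ℕ} {I : Finset (Fin n)}
    (hI : I.card ≤ w) {ρ : Fin n → Bool}
    (hz : ∀ z : Fin n → Bool, (∀ i ∈ I, z i = ρ i) → C.FalsifiedBy z) :
    DerivesWithin F w h (falseLits ρ I) := by
  have hsub : C.lits ⊆ falseLits ρ I := by
    intro l hl
    refine mem_falseLits.2 ⟨?_, hz ρ (fun _ _ => rfl) l hl⟩
    by_contra hlI
    refine hz (Function.update ρ l.1 l.2) (fun i hi => ?_) l hl (Function.update_self ..)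
    have hil : i ≠ l.1 := by
      rintro rfl
      exact hlI hi
    rw [Function.update_of_ne hil]
  exact ⟨C, .initial hC ((card_le_card hsub).trans ((card_falseLits_le _ _).trans hI)), hsub⟩

lemma Treated.insert (G : TriangleDAG (compose (Search F) (IND m))) {ht : G.V → ℕ}
    (hht : ∀ u, ∀ v ∈ G.children u, ht v < ht u)
    (hr : 1 ≤ 2 * r) (hn : 1 ≤ n) (hT : 1 ≤ T) (hm : 0 < m) (hrm : 2 * r ≤ m)
    (hq : 4 * T * √n ≤ 0.03 * r) [DecidableEq G.V] {D : Finset G.V} {v : G.V} (hv : v ∉ D)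
    (hch : ∀ c ∈ G.children v, c ∈ D) (hD : Treated G ht w T r D) :
    Treated G ht w T r (insert v D) := by
  classical
  obtain ⟨A, B, M, β, hA, hB, hM, hβ, hβd, hfull⟩ := hD
  have hr0 : 0 < r := by linarith
  obtain ⟨A', hA'A, hA'card, hstep⟩ : ∃ A' ⊆ A,
      ((A \ A').card : ℝ) ≤ 4 * (2 * r / m) ^ (w + 1) * (m : ℝ) ^ n ∧
      ∀ x ∈ A', ∀ I : Finset (Fin n), I.card ≤ w → ∀ ρ : Fin n → Bool,
        (∀ z : Fin n → Bool, (∀ i ∈ I, z i = ρ i) →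
          ∃ y ∈ B, (x, y) ∈ G.shape v ∧ gadgetBits x y = z) →
        DerivesWithin F w (ht v * w) (falseLits ρ I) := by
    by_cases hleaf : G.children v = ∅
    · obtain ⟨o, ho⟩ := G.shape_leaf v hleaf
      refine ⟨A, Subset.rfl, ?_, fun x _ I hI ρ hz => ?_⟩
      · rw [sdiff_self, bot_eq_empty, card_empty, Nat.cast_zero]; positivity
      · refine derivesWithin_of_leaf (C := F.get o) (List.get_mem _ _) hI fun z hzI => ?_
        obtain ⟨y, -, hxy, rfl⟩ := hz z hzI
        exact ho hxy
    · obtain ⟨c₀, c₁, hc₀, hc₁, hcc⟩ : ∃ c₀ c₁, c₀ ∈ G.children v ∧ c₁ ∈ G.children v ∧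
          ∀ c ∈ G.children v, c = c₀ ∨ c = c₁ := by
        have h1 := G.card_children_le v
        have h2 : 0 < (G.children v).card := card_pos.2 (nonempty_iff_ne_empty.2 hleaf)
        obtain h | h : (G.children v).card = 1 ∨ (G.children v).card = 2 := by omega
        · obtain ⟨c, hc⟩ := card_eq_one.1 h
          exact ⟨c, c, by simp [hc], by simp [hc], by simp [hc]⟩
        · obtain ⟨c₀, c₁, -, hc⟩ := card_eq_two.1 h
          exact ⟨c₀, c₁, by simp [hc], by simp [hc], by simp [hc]⟩
      refine ⟨A.filter fun x => (β c₀ x ∪ β c₁ x).card ≤ w, filter_subset _ _, ?_, ?_⟩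
      · have := card_filter_lt_card_union_le (w := w) hr0 hm hrm A (hM c₀ (hch _ hc₀))
          (hM c₁ (hch _ hc₁)) (hβ c₀ (hch _ hc₀)) (hβ c₁ (hch _ hc₁))
        refine le_trans (Nat.cast_le.2 (card_le_card fun x hx => ?_)) this
        rw [mem_sdiff, mem_filter, not_and] at hx
        exact mem_filter.2 ⟨hx.1, not_le.1 (hx.2 hx.1)⟩
      · intro x hx I _ ρ hz
        obtain ⟨hxA, hxw⟩ := mem_filter.1 hx
        have hq := DerivesWithin.query_all (F := F) (w := w) (h := (ht v - 1) * w)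
          (I := (β c₀ x ∪ β c₁ x).image Prod.fst) (G := I) (ρ := ρ) (card_image_le.trans hxw) ?_
        · refine hq.mono (le_of_eq ?_) Subset.rfl
          have := hht v c₀ hc₀
          rw [← Nat.succ_mul]
          congr 1
          omega
        · intro z hzI
          obtain ⟨y, hyB, hxy, rfl⟩ := hz z hzI
          obtain ⟨c, hc, hxc⟩ := Set.mem_iUnion₂.1 (G.shape_inner v hleaf hxy)
          have hsub : β c x ⊆ β c₀ x ∪ β c₁ x := by
            rcases hcc c hc with rfl | rfl
            exacts [subset_union_left, subset_union_right]
          refine (hβd c (hch c hc) x hxA y hyB hxc ((card_le_card hsub).trans hxw)).mono ?_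
            (falseLits_mono _ (image_subset_image hsub))
          have := hht v c hc
          exact Nat.mul_le_mul_right _ (by omega)
  obtain ⟨a, b, hab⟩ := G.shape_mem v
  have hshape : ∀ x y, (x, y) ∈ G.shape v ↔ a x < b y := by
    intro x y
    rw [hab]
    rfl
  obtain ⟨M', β', B', hB'B, hB'card, hM', hβ', hβd'⟩ := exists_handling_of_triangle
    (F := F) (w := w) (h := ht v * w) hr hn hT hq A' B a b
    (by simpa only [hshape] using hstep)
  have hne : ∀ u ∈ D, u ≠ v := by
    rintro u hu rfl
    exact hv hu
  have hAcard : (A.card : ℝ) = A'.card + (A \ A').card := by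
    exact_mod_cast (by rw [card_sdiff_of_subset hA'A]; have := card_le_card hA'A; omega)
  have hBcard : (B.card : ℝ) = B'.card + (B \ B').card := by
    exact_mod_cast (by rw [card_sdiff_of_subset hB'B]; have := card_le_card hB'B; omega)
  refine ⟨A', B', Function.update M v M', Function.update β v β', ?_, ?_, ?_, ?_, ?_, ?_⟩
  · rw [card_insert_of_notMem hv]
    push_cast
    linarith
  · rw [card_insert_of_notMem hv]
    push_cast
    linarith
  · intro u hu
    rcases mem_insert.1 hu with rfl | hu
    · rwa [Function.update_self]
    · rw [Function.update_of_ne (hne u hu)]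
      exact hM u hu
  · intro u hu x hx
    rcases mem_insert.1 hu with rfl | hu
    · rw [Function.update_self, Function.update_self]
      exact hβ' x hx
    · rw [Function.update_of_ne (hne u hu), Function.update_of_ne (hne u hu)]
      exact hβ u hu x (hA'A hx)
  · intro u hu x hx y hy hxy
    rcases mem_insert.1 hu with rfl | hu
    · rw [Function.update_self]
      exact hβd' x hx y hy ((hshape x y).1 hxy)
    · rw [Function.update_of_ne (hne u hu)]
      exact hβd u hu x (hA'A hx) y (hB'B hy) hxy
  · intro u hu x hx I hI ρ hz
    rcases mem_insert.1 hu with rfl | hu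
    · refine hstep x hx I hI ρ fun z hzI => ?_
      obtain ⟨y, hy, h⟩ := hz z hzI
      exact ⟨y, hB'B hy, h⟩
    · refine hfull u hu x (hA'A hx) I hI ρ fun z hzI => ?_
      obtain ⟨y, hy, h⟩ := hz z hzI
      exact ⟨y, hB'B hy, h⟩

/-- The lifting theorem in terms of the parameters of the argument. -/
theorem derivesWithin_empty_of_triangleDAG (G : TriangleDAG (compose (Search F) (IND m)))
    {ht : G.V → ℕ} (hht : ∀ u, ∀ v ∈ G.children u, ht v < ht u)
    (hr : 1 ≤ 2 * r) (hn : 1 ≤ n) (hT : 1 ≤ T) (hm : 0 < m) (hrm : 2 * r ≤ m)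
    (hq : 4 * T * √n ≤ 0.03 * r)
    (hX : G.size * (4 * (2 * r / m) ^ (w + 1)) + r / (2 * m) < 1)
    (hY : G.size * (2 * (2 * r) ^ w * (2 * Real.exp (-2) ^ T)) + 2 * Real.exp (-2) ^ T < 1) :
    DerivesWithin F w (ht G.root * w) ∅ := by
  classical
  let _ := G.fintypeV
  have htreated : ∀ D : Finset G.V, (∀ u ∈ D, ∀ c ∈ G.children u, c ∈ D) →
      Treated G ht w T r D := by
    intro D
    induction D using Finset.induction_on_max_value ht with
    | empty =>
      intro _
      refine ⟨univ, univ, fun _ => ∅, fun _ _ => ∅, ?_, ?_, ?_⟩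
      · simp
      · simp [← pow_mul, mul_comm m n]
      · simp
    | insert v D hv hmax ih =>
      intro hcl
      have hch : ∀ u ∈ insert v D, ∀ c ∈ G.children u, c ∈ D := by
        intro u hu c hc
        refine (mem_insert.1 (hcl u hu c hc)).resolve_left ?_
        rintro rfl
        have h1 := hht u c hc
        rcases mem_insert.1 hu with rfl | hu
        · exact lt_irrefl _ h1
        · exact absurd (hmax u hu) (not_le.2 h1)
      exact Treated.insert G hht hr hn hT hm hrm hq hv (hch v (mem_insert_self _ _))
        (ih fun u hu => hch u (mem_insert_of_mem hu))
  obtain ⟨A, B, M, β, hA, hB, -, -, -, hfull⟩ := htreated univ fun _ _ _ _ => mem_univ _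
  by_contra hcon
  have hm' : (0 : ℝ) < m := by exact_mod_cast hm
  have hmiss : ∀ x, ∃ z : Fin n → Bool, x ∈ A → ∀ y ∈ B, gadgetBits x y ≠ z := by
    intro x
    by_cases hx : x ∈ A
    · have := mt (hfull G.root (mem_univ _) x hx ∅ (by simp) fun _ => true) hcon
      push Not at this
      obtain ⟨z, -, hz⟩ := this
      exact ⟨z, fun _ y hy => hz y hy (by rw [G.shape_root]; trivial)⟩
    · exact ⟨fun _ => true, fun h => absurd h hx⟩
  choose z hz using hmiss
  have hsize : ((univ : Finset G.V).card : ℝ) = G.size := rfl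
  rw [hsize] at hA hB
  have hns : ¬ IsSmall r (1 / 2) (link graphSet A ∅) := by
    refine not_isSmall_link_empty (by linarith) hm hrm ?_
    have := mul_lt_mul_of_pos_right hX (pow_pos hm' n)
    linarith
  have hBle := card_le_of_missing_patterns (by linarith) hn hT hq A ∅ hns B z fun y hy x hx _ => by
    obtain ⟨i, hi⟩ := Function.ne_iff.1 (hz x hx y hy)
    exact ⟨i, notMem_empty _, hi⟩
  have := mul_lt_mul_of_pos_right hY (show (0 : ℝ) < 2 ^ (n * m) by positivity)
  linarith

end Dag

/-! ### Choice of the parameters -/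

section Parameters

lemma log_fifty_bounds : (3.6 : ℝ) ≤ Real.log 50 ∧ Real.log 50 ≤ 4 := by
  have h1 : Real.exp 1 < 2.7182818286 := Real.exp_one_lt_d9
  have h2 : 2.7182818283 < Real.exp 1 := Real.exp_one_gt_d9
  constructor
  · have h3 : (18 : ℝ) ≤ Real.log (50 ^ 5) := by
      rw [Real.le_log_iff_exp_le (by norm_num), show (18 : ℝ) = (18 : ℕ) * 1 by norm_num,
        Real.exp_nat_mul]
      calc Real.exp 1 ^ 18 ≤ 2.7182818286 ^ 18 := by gcongr
        _ ≤ 50 ^ 5 := by norm_num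
    rw [Real.log_pow] at h3
    push_cast at h3
    linarith
  · rw [Real.log_le_iff_le_exp (by norm_num), show (4 : ℝ) = (4 : ℕ) * 1 by norm_num,
      Real.exp_nat_mul]
    calc (50 : ℝ) ≤ 2.7182818283 ^ 4 := by norm_num
      _ ≤ Real.exp 1 ^ 4 := by gcongr

/-- An exponential beats `κ * √n`, once it is at least `50 * n`. -/
lemma mul_sqrt_le_exp {n : ℕ} (hn : 1 ≤ n) {κ : ℝ} (h : 50 * n ≤ Real.exp κ) :
    12.5 * κ * √n ≤ Real.exp κ := by
  have hn' : (1 : ℝ) ≤ n := by exact_mod_cast hn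
  have hs : 1 ≤ √(n : ℝ) := Real.one_le_sqrt.2 hn'
  have hss : √(n : ℝ) * √n = n := Real.mul_self_sqrt (by linarith)
  obtain ⟨hl1, hl2⟩ := log_fifty_bounds
  set u := Real.log (50 * n) with hu
  have hu1 : u = Real.log 50 + Real.log n := Real.log_mul (by norm_num) (by linarith)
  have hlogn : 0 ≤ Real.log n := Real.log_nonneg hn'
  have hu2 : u ≤ 4 * √n := by
    have h1 : Real.log n = 2 * Real.log √n := by
      rw [← hss, Real.log_mul (by linarith) (by linarith), hss]; ring
    have h2 := Real.log_le_sub_one_of_pos (show 0 < √(n : ℝ) by linarith)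
    linarith
  have hκu : u ≤ κ := (Real.log_le_iff_le_exp (by linarith)).2 h
  have hexp : Real.exp κ = 50 * n * Real.exp (κ - u) := by
    rw [Real.exp_sub, hu, Real.exp_log (by linarith)]
    field_simp
  have h3 := Real.add_one_le_exp (κ - u)
  have h4 : κ ≤ u * (κ - u + 1) := by nlinarith
  have h5 : κ ≤ 4 * √n * Real.exp (κ - u) :=
    h4.trans (mul_le_mul hu2 h3 (by linarith) (by linarith))
  rw [hexp]
  calc 12.5 * κ * √n ≤ 12.5 * (4 * √n * Real.exp (κ - u)) * √n := by gcongr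
    _ = 50 * (√n * √n) * Real.exp (κ - u) := by ring
    _ = _ := by rw [hss]

/-- The number of rounds affordable with the given gadget size. -/
lemma rounds_le_rpow {n : ℕ} (hn : 1 ≤ n) {m δ : ℝ} (hδ : 0 < δ) (hδ1 : δ < 1) (hm0 : 0 < m)
    (hm : 50 * n / δ ≤ m ^ (δ / 2)) :
    200 * (n * Real.log m + 4) * √n ≤ m ^ δ := by
  have hn' : (1 : ℝ) ≤ n := by exact_mod_cast hn
  set κ := Real.log m * (δ / 2) with hκ
  have hE : m ^ (δ / 2) = Real.exp κ := Real.rpow_def_of_pos hm0 _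
  have hE2 : m ^ δ = Real.exp κ * Real.exp κ := by
    rw [Real.rpow_def_of_pos hm0, ← Real.exp_add, hκ]
    congr 1
    ring
  rw [hE, div_le_iff₀ hδ] at hm
  have hEpos := Real.exp_pos κ
  have h50 : 50 * n ≤ Real.exp κ := by nlinarith
  have h1 := mul_sqrt_le_exp hn h50
  have hκ36 : 3.6 ≤ κ := by
    refine log_fifty_bounds.1.trans ?_
    rw [Real.log_le_iff_le_exp (by norm_num)]
    linarith
  have hκpos : 0 < κ := by linarith
  have hnL : n * Real.log m ≤ κ * Real.exp κ / 25 := by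
    have h2 : n * Real.log m * δ = 2 * n * κ := by rw [hκ]; ring
    have h3 : n * Real.log m * δ ≤ κ * Real.exp κ / 25 * δ := by
      rw [h2]
      nlinarith
    exact le_of_mul_le_mul_right h3 hδ
  have h4 : 4 ≤ 0.0224 * (κ * Real.exp κ) := by nlinarith
  rw [hE2]
  calc 200 * (n * Real.log m + 4) * √n ≤ 200 * (0.0625 * (κ * Real.exp κ)) * √n := by
        gcongr
        linarith
    _ = 12.5 * κ * √n * Real.exp κ := by ring
    _ ≤ _ := by gcongr

end Parameters

end DagLifting


theorem mainTheorem7 (n m w d : ℕ) (δ : ℝ) (F : CNF n) (hF : Unsatisfiable F)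
    (hw : w ≤ n) (hδ_pos : 0 < δ) (hδ_lt : δ < 1 - 1 / Real.logb 2 m)
    (hm : (50 * (n : ℝ) / δ) ^ (2 / δ) ≤ (m : ℝ))
    (G : TriangleDAG (compose (Search F) (IND m)))
    (hsize : (G.size : ℝ) ≤ 1 / 2 * (m : ℝ) ^ ((1 - δ) * (w : ℝ)))
    (hdepth : G.depth ≤ (d : ℕ∞)) :
    ∃ P : Refutation F, P.width ≤ w ∧ P.depth ≤ ((d * w : ℕ) : ℕ∞) := by
  -- the DAG has at least one node, which rules out `w = 0`
  have hsize1 : (1 : ℝ) ≤ G.size := by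
    let _ := G.fintypeV
    exact_mod_cast (Fintype.card_pos_iff.2 ⟨G.root⟩ : 0 < Fintype.card G.V)
  have hw1 : 1 ≤ w := by
    rw [Nat.one_le_iff_ne_zero]
    rintro rfl
    rw [Nat.cast_zero, mul_zero, Real.rpow_zero] at hsize
    linarith
  have hn : 1 ≤ n := hw1.trans hw
  have hn' : (1 : ℝ) ≤ n := by exact_mod_cast hn
  have hlogb : 0 ≤ 1 / Real.logb 2 m := by
    rw [Real.logb]
    exact div_nonneg zero_le_one
      (div_nonneg (Real.log_natCast_nonneg m) (Real.log_nonneg one_le_two))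
  have hδ1 : δ < 1 := by linarith
  have hbase : 50 ≤ 50 * (n : ℝ) / δ := by
    rw [le_div_iff₀ hδ_pos]
    nlinarith
  have hm1 : (1 : ℝ) < m :=
    lt_of_lt_of_le (Real.one_lt_rpow (by linarith) (by positivity)) hm
  have hm0 : (0 : ℝ) < m := by linarith
  have hmpos : 0 < m := by exact_mod_cast hm0
  have hmδ : 50 * (n : ℝ) / δ ≤ (m : ℝ) ^ (δ / 2) := by
    have h1 := Real.rpow_le_rpow (by positivity) hm (show 0 ≤ δ / 2 by positivity)
    rwa [← Real.rpow_mul (by positivity), show 2 / δ * (δ / 2) = 1 by field_simp,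
      Real.rpow_one] at h1
  have hrounds := rounds_le_rpow hn hδ_pos hδ1 hm0 hmδ
  set p : ℝ := (m : ℝ) ^ δ with hp
  set q : ℝ := (m : ℝ) ^ (1 - δ) with hq
  have hpq : p * q = m := by
    rw [hp, hq, ← Real.rpow_add hm0, add_sub_cancel, Real.rpow_one]
  have hq2 : 2 < q := by
    have hlb : 0 < Real.logb 2 m := Real.logb_pos one_lt_two hm1
    have h1 : 1 / Real.logb 2 m < 1 - δ := by linarith
    rw [div_lt_iff₀ hlb] at h1
    have h2 : q = (2 : ℝ) ^ (Real.logb 2 m * (1 - δ)) := by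
      rw [Real.rpow_mul zero_le_two, Real.rpow_logb zero_lt_two (by norm_num) hm0]
    rw [h2]
    calc (2 : ℝ) = 2 ^ (1 : ℝ) := (Real.rpow_one 2).symm
      _ < _ := Real.rpow_lt_rpow_of_exponent_lt one_lt_two (by linarith)
  have hLpos : 0 < Real.log m := Real.log_pos hm1
  have hp800 : 800 ≤ p := by
    have h1 : 1 ≤ √(n : ℝ) := Real.one_le_sqrt.2 hn'
    have h2 : 0 ≤ n * Real.log m := by positivity
    nlinarith
  set T := ⌈(n * Real.log m + 2) / 2⌉₊ with hT
  have hT1 : (n * Real.log m + 2) / 2 ≤ T := Nat.le_ceil _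
  have hT2 : (T : ℝ) < (n * Real.log m + 2) / 2 + 1 := Nat.ceil_lt_add_one (by positivity)
  have hTpos : 1 ≤ T := by
    rw [hT, Nat.one_le_ceil_iff]
    positivity
  -- the failure probability of the sunflower argument
  have hε : (m : ℝ) ^ n * Real.exp (-2) ^ T ≤ 0.14 := by
    have h1 : (m : ℝ) ^ n = Real.exp (n * Real.log m) := by
      rw [Real.exp_nat_mul, Real.exp_log hm0]
    have h2 : Real.exp 1 > 2.7182818283 := Real.exp_one_gt_d9
    have h3 : (7.2 : ℝ) ≤ Real.exp 2 := by
      rw [show (2 : ℝ) = 1 + 1 by norm_num, Real.exp_add]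
      nlinarith
    rw [h1, ← Real.exp_nat_mul, ← Real.exp_add]
    calc Real.exp (n * Real.log m + T * -2) ≤ Real.exp (-2) := Real.exp_le_exp.2 (by linarith)
      _ = (Real.exp 2)⁻¹ := Real.exp_neg 2
      _ ≤ 7.2⁻¹ := inv_anti₀ (by norm_num) h3
      _ ≤ 0.14 := by norm_num
  have hε1 : Real.exp (-2) ^ T ≤ 0.14 := by
    refine le_trans ?_ hε
    exact le_mul_of_one_le_left (by positivity) (one_le_pow₀ hm1.le)
  have hsize' : (G.size : ℝ) ≤ 1 / 2 * q ^ w := by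
    rwa [Real.rpow_mul hm0.le, Real.rpow_natCast] at hsize
  have hp0 : 0 < p := by linarith
  have hq0 : 0 < q := by linarith
  have hrq : 2 * (p / 3) / m = 2 / 3 / q := by
    rw [← hpq]
    field_simp
  have h23 : (2 / 3 : ℝ) ^ w ≤ 2 / 3 := by
    calc (2 / 3 : ℝ) ^ w ≤ (2 / 3) ^ 1 := pow_le_pow_of_le_one (by norm_num) (by norm_num) hw1
      _ = _ := pow_one _
  have hround : 4 * T * √n ≤ 0.03 * (p / 3) := by
    have h1 : 0 ≤ √(n : ℝ) := Real.sqrt_nonneg _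
    have h2 : 4 * T * √n ≤ 2 * (n * Real.log m + 4) * √n :=
      mul_le_mul_of_nonneg_right (by linarith) h1
    linarith
  have hX : G.size * (4 * (2 * (p / 3) / m) ^ (w + 1)) + p / 3 / (2 * m) < 1 := by
    rw [hrq]
    have h1 : G.size * (4 * (2 / 3 / q) ^ (w + 1)) ≤
        1 / 2 * q ^ w * (4 * (2 / 3 / q) ^ (w + 1)) := by
      gcongr
    have h2 : 1 / 2 * q ^ w * (4 * (2 / 3 / q) ^ (w + 1)) = 4 / 3 * (2 / 3) ^ w / q := by
      rw [div_pow, pow_succ, pow_succ]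
      field_simp
    have h3 : 4 / 3 * (2 / 3) ^ w / q ≤ 4 / 9 := by
      rw [div_le_iff₀ hq0]
      linarith
    have h4 : p / 3 / (2 * m) = 1 / 6 / q := by
      rw [← hpq]
      field_simp
      norm_num
    have h5 : 1 / 6 / q ≤ 1 / 12 := by
      rw [div_le_iff₀ hq0]
      linarith
    rw [h4]
    linarith
  have hY : G.size * (2 * (2 * (p / 3)) ^ w * (2 * Real.exp (-2) ^ T)) +
      2 * Real.exp (-2) ^ T < 1 := by
    have hwn : (m : ℝ) ^ w ≤ (m : ℝ) ^ n := pow_le_pow_right₀ hm1.le hw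
    set e := Real.exp (-2) ^ T with he
    have he0 : 0 < e := by positivity
    have h1 : G.size * (2 * (2 * (p / 3)) ^ w * (2 * e)) ≤
        1 / 2 * q ^ w * (2 * (2 * (p / 3)) ^ w * (2 * e)) := by
      gcongr
    have h2 : 1 / 2 * q ^ w * (2 * (2 * (p / 3)) ^ w * (2 * e)) =
        2 * (2 / 3) ^ w * ((m : ℝ) ^ w * e) := by
      rw [← hpq, show 2 * (p / 3) = 2 / 3 * p by ring, mul_pow, mul_pow]
      ring
    have h3 : (m : ℝ) ^ w * e ≤ 0.14 := (mul_le_mul_of_nonneg_right hwn he0.le).trans hε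
    have h4 : 2 * (2 / 3 : ℝ) ^ w * ((m : ℝ) ^ w * e) ≤ 2 * (2 / 3) * 0.14 := by
      gcongr
    linarith
  obtain ⟨ht, hht, hroot⟩ := G.exists_height hdepth
  obtain ⟨C, hC, hC0⟩ := derivesWithin_empty_of_triangleDAG (F := F) G hht
    (by linarith) hn hTpos hmpos (by nlinarith) hround hX hY
  exact (hC.mono (Nat.mul_le_mul_right w hroot)).exists_refutation (Finset.subset_empty.1 hC0)
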